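/- There is a universal constant $C>0$ with the following property. Let $X\subseteq\mathbb{R}^n$ and $Y\subseteq\mathbb{R}^m$ be nonempty compact convex sets with diameters at most $D_x>0$ and $D_y>0$, let $x_0\in X$, $y_0\in Y$, let $L_x,L_{xy},L_y\ge 0$, $L=\max\{L_x,L_{xy},L_y\}$, and let $\epsilon>0$. There is a deterministic first-order method, which accesses its input function $f$ only through evaluations of $(\nabla_x f,\nabla_y f)$ at points of $X\times Y$ of its choice, such that for every function $f(x,y)$ that is convex in $x\in X$ for every $y\in Y$, concave in $y\in Y$ for every $x\in X$, and $(L_x,L_{xy},L_y)$-smooth on $X\times Y$ (that is, $f$ is differentiable at the points of $X\times Y$ and there $\nabla_x f(\cdot,y)$ is $L_x$-Lipschitz, $\nabla_y f(x,\cdot)$ is $L_y$-Lipschitz, and $\nabla_x f(x,\cdot)$ and $\nabla_y f(\cdot,y)$ are $L_{xy}$-Lipschitz), the method returns a point $(\hat x,\hat y)\in X\times Y$ that is an $(\epsilon/2)$-saddle point of the regularized function $$f_\epsilon(x,y)=f(x,y)+\frac{\epsilon\|x-x_0\|^2}{4D_x^2}-\frac{\epsilon\|y-y_0\|^2}{4D_y^2}$$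 and an $\epsilon$-saddle point of $f$, i.e. $$\max_{y\in Y}f(\hat x,y)-\min_{x\in X}f(x,\hat y)\le\epsilon ,$$ after at most $$C\left(1+\sqrt{\frac{L_xD_x^2+L_yD_y^2}{\epsilon}}+\frac{D_xD_y\sqrt{L\cdot L_{xy}}}{\epsilon}\right)\ln^4\!\left(2+\frac{L(D_x+D_y)^2}{\epsilon}\right)$$ gradient evaluations. (For fixed diameters this is $\tilde O\bigl(\sqrt{(L_x+L_y)/\epsilon}+\sqrt{L\cdot L_{xy}}/\epsilon\bigr)$.) -/

import Mathlib

/-- `ℝⁿ` with its Euclidean norm and inner product. -/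
abbrev Eucl (n : ℕ) : Type := EuclideanSpace ℝ (Fin n)

/-- The partial gradient `∇ₓ f(x, y)`. -/
noncomputable def gradX {n m : ℕ} (f : Eucl n → Eucl m → ℝ) (x : Eucl n) (y : Eucl m) : Eucl n :=
  gradient (fun u => f u y) x

/-- The partial gradient `∇_y f(x, y)`. -/
noncomputable def gradY {n m : ℕ} (f : Eucl n → Eucl m → ℝ) (x : Eucl n) (y : Eucl m) : Eucl m :=
  gradient (fun v => f x v) y

/-- `f` is differentiable and `(Lx, Lxy, Ly)`-smooth on `X × Y`.  Nothing is required of `f` away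
from the points of `X × Y`. -/
structure IsSmoothOn {n m : ℕ} (X : Set (Eucl n)) (Y : Set (Eucl m)) (Lx Lxy Ly : ℝ)
    (f : Eucl n → Eucl m → ℝ) : Prop where
  differentiableAt : ∀ x ∈ X, ∀ y ∈ Y,
    DifferentiableAt ℝ (fun p : Eucl n × Eucl m => f p.1 p.2) (x, y)
  lip_x : ∀ y ∈ Y, ∀ x ∈ X, ∀ x' ∈ X, ‖gradX f x y - gradX f x' y‖ ≤ Lx * ‖x - x'‖
  lip_y : ∀ x ∈ X, ∀ y ∈ Y, ∀ y' ∈ Y, ‖gradY f x y - gradY f x y'‖ ≤ Ly * ‖y - y'‖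
  lip_xy : ∀ x ∈ X, ∀ y ∈ Y, ∀ y' ∈ Y, ‖gradX f x y - gradX f x y'‖ ≤ Lxy * ‖y - y'‖
  lip_yx : ∀ y ∈ Y, ∀ x ∈ X, ∀ x' ∈ X, ‖gradY f x y - gradY f x' y‖ ≤ Lxy * ‖x - x'‖

/-- `f` is convex in `x ∈ X` for each `y ∈ Y` and concave in `y ∈ Y` for each `x ∈ X`. -/
structure IsConvexConcaveOn {n m : ℕ} (X : Set (Eucl n)) (Y : Set (Eucl m))
    (f : Eucl n → Eucl m → ℝ) : Prop where
  convex : ∀ y ∈ Y, ConvexOn ℝ X (fun x => f x y)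
  concave : ∀ x ∈ X, ConcaveOn ℝ Y (fun y => f x y)

/-- `(x', y') ∈ X × Y` is an `ε`-saddle point of `f` on `X × Y`:
`max_{y ∈ Y} f(x', y) - min_{x ∈ X} f(x, y') ≤ ε`, where the maximum and the minimum are
attained. -/
def IsEpsSaddle {n m : ℕ} (X : Set (Eucl n)) (Y : Set (Eucl m)) (f : Eucl n → Eucl m → ℝ)
    (ε : ℝ) (x' : Eucl n) (y' : Eucl m) : Prop :=
  x' ∈ X ∧ y' ∈ Y ∧ ∃ M μ : ℝ, IsGreatest ((fun y => f x' y) '' Y) M ∧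
    IsLeast ((fun x => f x y') '' X) μ ∧ M - μ ≤ ε

/-- The function regularized in both variables,
`f(x, y) + ε ‖x - x₀‖² / (4 Dx²) - ε ‖y - y₀‖² / (4 Dy²)`. -/
noncomputable def regularized {n m : ℕ} (f : Eucl n → Eucl m → ℝ) (ε Dx Dy : ℝ)
    (x₀ : Eucl n) (y₀ : Eucl m) (x : Eucl n) (y : Eucl m) : ℝ :=
  f x y + ε * ‖x - x₀‖ ^ 2 / (4 * Dx ^ 2) - ε * ‖y - y₀‖ ^ 2 / (4 * Dy ^ 2)

/-- A deterministic algorithm that learns about its input only by asking an oracle: either it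
stops and returns a result, or it asks a question in `Q` and continues in a way that depends on
the answer in `A`. -/
inductive OracleAlg (Q A R : Type) : Type
  | done (r : R) : OracleAlg Q A R
  | ask (q : Q) (next : A → OracleAlg Q A R) : OracleAlg Q A R

/-- The result of an algorithm when the oracle answers according to `o`. -/
def OracleAlg.result {Q A R : Type} (o : Q → A) : OracleAlg Q A R → R
  | .done r => r
  | .ask q next => OracleAlg.result o (next (o q))

/-- The number of questions asked when the oracle answers according to `o`. -/
def OracleAlg.cost {Q A R : Type} (o : Q → A) : OracleAlg Q A R → ℕ
  | .done _ => 0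
  | .ask q next => OracleAlg.cost o (next (o q)) + 1

/-- A first-order method for the minimax problem on `X × Y`: its questions are points of `X × Y`,
the answers are pairs of partial gradients, and its result is a point of `X × Y`. -/
abbrev FirstOrderMethod {n m : ℕ} (X : Set (Eucl n)) (Y : Set (Eucl m)) : Type :=
  OracleAlg (X × Y) (Eucl n × Eucl m) (X × Y)

/-- The gradient oracle of `f` on `X × Y`. -/
noncomputable def gradOracle {n m : ℕ} (X : Set (Eucl n)) (Y : Set (Eucl m))
    (f : Eucl n → Eucl m → ℝ) (z : X × Y) : Eucl n × Eucl m :=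
  (gradX f z.1 z.2, gradY f z.1 z.2)

/-! Regularization makes the objective strongly convex in x with modulus μx = ε/(2Dx²) and strongly
concave in y with modulus μy = ε/(2Dy²), and it changes duality gaps by at most ε/2. It remains to
solve a well-conditioned saddle problem.

If the coupling is weak, 4 Lxy² ≤ ab for the moduli a and b, simultaneous best responses contract
towards the saddle point. Each is a smooth strongly convex minimization, done by accelerated
gradients (`exists_accelerated_minimizer`, `ReducesWithin.of_weak_coupling`).

Strong coupling is made weak by proximal terms of sizes κx μx and κy μy. The one in x is removed by
accelerated gradient descent on the Moreau envelope of the primal function, whose gradient is read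
off an approximate saddle point of the proximal problem (`ReducesWithin.accelerate`). This takes
about √κx rounds; y is symmetric. The total is √(κx κy) (1 + √(Lx/(κx μx)) + √(Ly/(κy μy))) times
four logarithms, one per nested loop. Weak coupling needs κx κy ≥ 4 Lxy²/(μx μy). The choice in
`exists_prox_parameters`, roughly κx = 2 Lxy/μx and κy = 2 Lxy/μy, produces the term √(L Lxy/(μx
μy)).

The solver controls only the distance to the saddle point. The data do not bound the gradients of f,
so a small distance does not by itself give a small gap; one projected gradient step does
(`SaddleOracle.gap_projected_step_le`). All accuracies are polynomial in Λ = 2 + L(Dx + Dy)²/ε, so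
every logarithm is O(log Λ). -/

open scoped RealInnerProductSpace

/-! ### Composition of oracle algorithms and their query counts. -/

section OracleComputation

variable {Q A R S Q' A' : Type}

/-- `r` is computed from the oracle by an algorithm that asks at most `N` questions. -/
def ComputableWithin (N : ℕ) (r : (Q → A) → R) : Prop :=
  ∃ alg : OracleAlg Q A R, ∀ o, alg.result o = r o ∧ alg.cost o ≤ N

/-- Sequential composition of oracle algorithms. -/
def OracleAlg.bind : OracleAlg Q A R → (R → OracleAlg Q A S) → OracleAlg Q A S
  | .done r, k => k r
  | .ask q next, k => .ask q fun a => (next a).bind k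

theorem OracleAlg.result_bind (o : Q → A) (alg : OracleAlg Q A R) (k : R → OracleAlg Q A S) :
    (alg.bind k).result o = (k (alg.result o)).result o := by
  induction alg with
  | done r => rfl
  | ask q next ih => exact ih (o q)

theorem OracleAlg.cost_bind (o : Q → A) (alg : OracleAlg Q A R) (k : R → OracleAlg Q A S) :
    (alg.bind k).cost o = alg.cost o + (k (alg.result o)).cost o := by
  induction alg with
  | done r => simp [OracleAlg.bind, OracleAlg.cost, OracleAlg.result]
  | ask q next ih =>
    simp only [OracleAlg.bind, OracleAlg.cost, OracleAlg.result, ih]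
    omega

/-- Run an algorithm for oracles `Q' → A'` when only an oracle `Q → A` is available, by
translating questions with `ψ` and answers with `φ`. -/
def OracleAlg.translate (φ : Q' → A → A') (ψ : Q' → Q) : OracleAlg Q' A' R → OracleAlg Q A R
  | .done r => .done r
  | .ask q next => .ask (ψ q) fun a => (next (φ q a)).translate φ ψ

theorem OracleAlg.result_translate (φ : Q' → A → A') (ψ : Q' → Q) (o : Q → A)
    (alg : OracleAlg Q' A' R) :
    (alg.translate φ ψ).result o = alg.result fun q => φ q (o (ψ q)) := by
  induction alg with
  | done r => rfl
  | ask q next ih => exact ih _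

theorem OracleAlg.cost_translate (φ : Q' → A → A') (ψ : Q' → Q) (o : Q → A)
    (alg : OracleAlg Q' A' R) :
    (alg.translate φ ψ).cost o = alg.cost fun q => φ q (o (ψ q)) := by
  induction alg with
  | done r => rfl
  | ask q next ih => exact congrArg (· + 1) (ih _)

namespace ComputableWithin

theorem pure (r : R) : ComputableWithin 0 (fun _ : Q → A => r) :=
  ⟨.done r, fun _ => ⟨rfl, le_rfl⟩⟩

theorem query (q : Q) : ComputableWithin 1 (fun o : Q → A => o q) :=
  ⟨.ask q .done, fun _ => ⟨rfl, le_rfl⟩⟩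

theorem bind {N M : ℕ} {r : (Q → A) → R} {s : R → (Q → A) → S} (hr : ComputableWithin N r)
    (hs : ∀ a, ComputableWithin M (s a)) : ComputableWithin (N + M) (fun o => s (r o) o) := by
  obtain ⟨alg, halg⟩ := hr
  choose k hk using hs
  refine ⟨alg.bind k, fun o => ⟨?_, ?_⟩⟩
  · rw [OracleAlg.result_bind, (hk _ o).1, (halg o).1]
  · rw [OracleAlg.cost_bind]
    exact add_le_add (halg o).2 (hk _ o).2

theorem map {N : ℕ} {r : (Q → A) → R} (hr : ComputableWithin N r) (h : R → S) :
    ComputableWithin N (fun o => h (r o)) :=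
  hr.bind (M := 0) (s := fun a _ => h a) fun a => pure (h a)

theorem mono {N M : ℕ} {r : (Q → A) → R} (hr : ComputableWithin N r) (h : N ≤ M) :
    ComputableWithin M r := by
  obtain ⟨alg, halg⟩ := hr
  exact ⟨alg, fun o => ⟨(halg o).1, (halg o).2.trans h⟩⟩

/-- Simulates, at no extra cost, the oracle of the regularized or proximal problem, of the problem
with exchanged players, or of one player alone. -/
theorem translate {N : ℕ} {r : (Q' → A') → R} (hr : ComputableWithin N r) (φ : Q' → A → A')
    (ψ : Q' → Q) : ComputableWithin N (fun o : Q → A => r fun q => φ q (o (ψ q))) := by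
  obtain ⟨alg, halg⟩ := hr
  refine ⟨alg.translate φ ψ, fun o => ⟨?_, ?_⟩⟩
  · rw [OracleAlg.result_translate, (halg _).1]
  · rw [OracleAlg.cost_translate]
    exact (halg _).2

theorem iterate {N : ℕ} {step : (Q → A) → R → R}
    (h : ∀ s, ComputableWithin N (fun o => step o s)) (k : ℕ) (s : R) :
    ComputableWithin (k * N) (fun o => (step o)^[k] s) := by
  induction k generalizing s with
  | zero => simpa using pure s
  | succ k ih =>
    have := (h s).bind (s := fun s o => (step o)^[k] s) ih
    exact this.mono (by rw [Nat.succ_mul, add_comm])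

end ComputableWithin

end OracleComputation

/-! ### Weighted squared distances on the product. -/

/-- The squared distance with weights `a` and `b` on the two factors. -/
def wdist {E F : Type} [NormedAddCommGroup E] [NormedAddCommGroup F] {X : Set E} {Y : Set F}
    (a b : ℝ) (z z' : X × Y) : ℝ :=
  a * ‖(z.1 : E) - z'.1‖ ^ 2 + b * ‖(z.2 : F) - z'.2‖ ^ 2

theorem wdist_swap {E F : Type} [NormedAddCommGroup E] [NormedAddCommGroup F] {X : Set E}
    {Y : Set F} (a b : ℝ) (z z' : X × Y) : wdist b a z.swap z'.swap = wdist a b z z' :=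
  add_comm _ _

theorem wdist_comm {E F : Type} [NormedAddCommGroup E] [NormedAddCommGroup F] {X : Set E}
    {Y : Set F} (a b : ℝ) (z z' : X × Y) : wdist a b z z' = wdist a b z' z := by
  simp only [wdist, norm_sub_rev]

theorem wdist_nonneg {E F : Type} [NormedAddCommGroup E] [NormedAddCommGroup F] {X : Set E}
    {Y : Set F} {a b : ℝ} (ha : 0 ≤ a) (hb : 0 ≤ b) (z z' : X × Y) : 0 ≤ wdist a b z z' := by
  unfold wdist
  positivity

theorem wdist_triangle {E F : Type} [NormedAddCommGroup E] [NormedAddCommGroup F] {X : Set E}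
    {Y : Set F} {a b : ℝ} (ha : 0 ≤ a) (hb : 0 ≤ b) (z z' z'' : X × Y) :
    wdist a b z z'' ≤ 2 * wdist a b z z' + 2 * wdist a b z' z'' := by
  have aux : ∀ {c s t u : ℝ}, 0 ≤ c → 0 ≤ u → u ≤ s + t →
      c * u ^ 2 ≤ 2 * (c * s ^ 2) + 2 * (c * t ^ 2) := by
    intro c s t u hc hu h
    have h1 : u ^ 2 ≤ (s + t) ^ 2 := pow_le_pow_left₀ hu h 2
    nlinarith [mul_le_mul_of_nonneg_left h1 hc, mul_nonneg hc (sq_nonneg (s - t))]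
  have h1 := aux ha (norm_nonneg _) (norm_sub_le_norm_sub_add_norm_sub (z.1 : E) z'.1 z''.1)
  have h2 := aux hb (norm_nonneg _) (norm_sub_le_norm_sub_add_norm_sub (z.2 : F) z'.2 z''.2)
  unfold wdist
  linarith

/-! ### Existence of saddle points through strongly monotone variational inequalities. -/

section VariationalInequality

variable {E F : Type} [NormedAddCommGroup E] [InnerProductSpace ℝ E]
  [NormedAddCommGroup F] [InnerProductSpace ℝ F]

/-- The metric projection onto a closed convex set. -/
theorem exists_projection [CompleteSpace E] {K : Set E} (ne : K.Nonempty) (hc : IsClosed K) (hK : Convex ℝ K) :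
    ∃ P : E → K, ∀ u (w : K), ⟪u - P u, (w : E) - P u⟫ ≤ 0 := by
  choose P hP hmin using exists_norm_eq_iInf_of_complete_convex ne hc.isComplete hK
  exact ⟨fun u => ⟨P u, hP u⟩, fun u w =>
    (norm_eq_iInf_iff_real_inner_le_zero hK (hP u)).1 (hmin u) w w.2⟩

theorem projection_dist_le {K : Set E} {P : E → K}
    (hP : ∀ u (w : K), ⟪u - P u, (w : E) - P u⟫ ≤ 0) (u v : E) :
    ‖(P u : E) - P v‖ ≤ ‖u - v‖ := by
  have h1 := hP u (P v)
  have h2 := hP v (P u)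
  have h3 : ‖(P u : E) - P v‖ ^ 2 ≤ ⟪u - v, (P u : E) - P v⟫ := by
    rw [← real_inner_self_eq_norm_sq]
    simp only [inner_sub_left, inner_sub_right] at *
    linarith
  have h4 := real_inner_le_norm (u - v) ((P u : E) - P v)
  by_contra! h
  nlinarith [norm_nonneg (u - v)]

/-- A strongly monotone Lipschitz variational inequality on a closed convex set has a solution. -/
theorem exists_variationalInequality [CompleteSpace E] {K : Set E} (ne : K.Nonempty)
    (hc : IsClosed K) (hK : Convex ℝ K) (G : K → E) {μ L : ℝ} (hμ : 0 < μ)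
    (hmono : ∀ u v : K, μ * ‖(u : E) - v‖ ^ 2 ≤ ⟪G u - G v, (u : E) - v⟫)
    (hlip : ∀ u v : K, ‖G u - G v‖ ≤ L * ‖(u : E) - v‖) :
    ∃ z : K, ∀ w : K, 0 ≤ ⟪G z, (w : E) - z⟫ := by
  obtain ⟨P, hP⟩ := exists_projection ne hc hK
  -- Enlarging the Lipschitz constant to at least μ keeps 1 - (μ/l)² nonnegative. With step size
  -- μ/l² the projected step contracts by the square root of this number.
  set l := max L μ with hl
  have hlμ : μ ≤ l := le_max_right _ _
  have hl0 : 0 < l := hμ.trans_le hlμ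
  set η := μ / l ^ 2 with hη
  have hη0 : 0 < η := by positivity
  set T : K → K := fun u => P ((u : E) - η • G u) with hT
  have hq0 : 0 ≤ 1 - (μ / l) ^ 2 := by
    have : μ / l ≤ 1 := (div_le_one hl0).2 hlμ
    have : 0 ≤ μ / l := by positivity
    nlinarith
  have hcontr : ContractingWith (√(1 - (μ / l) ^ 2)).toNNReal T := by
    refine ⟨?_, LipschitzWith.of_dist_le_mul fun u v => ?_⟩
    · rw [Real.toNNReal_lt_one, Real.sqrt_lt' one_pos]
      have : 0 < (μ / l) ^ 2 := by positivity
      linarith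
    · rw [Subtype.dist_eq, Subtype.dist_eq, dist_eq_norm, dist_eq_norm]
      rw [Real.coe_toNNReal _ (Real.sqrt_nonneg _)]
      refine (projection_dist_le hP _ _).trans ?_
      refine abs_le_of_sq_le_sq' ?_ (by positivity) |>.2
      rw [mul_pow, Real.sq_sqrt hq0]
      have e : (u : E) - η • G u - (v - η • G v) = ((u : E) - v) - η • (G u - G v) := by
        module
      rw [e, norm_sub_sq_real, inner_smul_right, norm_smul, real_inner_comm,
        Real.norm_of_nonneg hη0.le, mul_pow]
      have h1 := hmono u v
      have h2 : ‖G u - G v‖ ^ 2 ≤ l ^ 2 * ‖(u : E) - v‖ ^ 2 := by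
        rw [← mul_pow]
        refine pow_le_pow_left₀ (norm_nonneg _) ((hlip u v).trans ?_) 2
        gcongr
        exact le_max_left _ _
      have e1 : η * μ = (μ / l) ^ 2 := by rw [hη]; field_simp
      have e2 : η ^ 2 * l ^ 2 = (μ / l) ^ 2 := by rw [hη]; field_simp
      have h3 := mul_le_mul_of_nonneg_left h1 hη0.le
      have h4 := mul_le_mul_of_nonneg_left h2 (sq_nonneg η)
      rw [← mul_assoc, e1] at h3
      rw [← mul_assoc, e2] at h4
      linarith
  have : CompleteSpace K := hc.completeSpace_coe
  obtain ⟨x₀, hx₀⟩ := ne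
  obtain ⟨z, hz, -⟩ := hcontr.exists_fixedPoint ⟨x₀, hx₀⟩ (edist_ne_top _ _)
  refine ⟨z, fun w => ?_⟩
  have h := hP ((z : E) - η • G z) w
  have hz' : P ((z : E) - η • G z) = z := hz
  rw [hz', sub_sub_cancel_left, inner_neg_left, inner_smul_left] at h
  simp only [conj_trivial] at h
  by_contra! hneg
  nlinarith [mul_neg_of_pos_of_neg hη0 hneg]

/-- `z` solves the variational inequality of the saddle operator `o` on `X × Y`. -/
def IsSaddle {X : Set E} {Y : Set F} (o : X × Y → E × F) (z : X × Y) : Prop :=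
  (∀ x : X, 0 ≤ ⟪(o z).1, (x : E) - z.1⟫) ∧ ∀ y : Y, 0 ≤ ⟪(o z).2, (y : F) - z.2⟫

/-- `o` answers with the partial gradient of `f` in `x` and the negative of its partial gradient
in `y`, where `f` is `a`-strongly convex in `x`, `b`-strongly concave in `y`, and smooth. -/
structure SaddleOracle (X : Set E) (Y : Set F) (a b Lx Ly Lxy : ℝ) (f : X → Y → ℝ)
    (o : X × Y → E × F) : Prop where
  convex : ∀ (x x' : X) (y : Y),
    f x y + ⟪(o (x, y)).1, (x' : E) - x⟫ + a / 2 * ‖(x' : E) - x‖ ^ 2 ≤ f x' y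
  concave : ∀ (x : X) (y y' : Y),
    f x y' ≤ f x y - ⟪(o (x, y)).2, (y' : F) - y⟫ - b / 2 * ‖(y' : F) - y‖ ^ 2
  lip_x : ∀ (x x' : X) (y : Y), ‖(o (x, y)).1 - (o (x', y)).1‖ ≤ Lx * ‖(x : E) - x'‖
  lip_y : ∀ (x : X) (y y' : Y), ‖(o (x, y)).2 - (o (x, y')).2‖ ≤ Ly * ‖(y : F) - y'‖
  lip_xy : ∀ (x : X) (y y' : Y), ‖(o (x, y)).1 - (o (x, y')).1‖ ≤ Lxy * ‖(y : F) - y'‖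
  lip_yx : ∀ (x x' : X) (y : Y), ‖(o (x, y)).2 - (o (x', y)).2‖ ≤ Lxy * ‖(x : E) - x'‖

namespace SaddleOracle

variable {X : Set E} {Y : Set F} {a b Lx Ly Lxy : ℝ} {f : X → Y → ℝ} {o : X × Y → E × F}

/-- Sum the convexity and concavity inequalities around the rectangle with corners `z` and `z'`; all
values of `f` cancel. -/
theorem strongly_monotone (h : SaddleOracle X Y a b Lx Ly Lxy f o) (z z' : X × Y) :
    wdist a b z z' ≤ ⟪(o z).1 - (o z').1, (z.1 : E) - z'.1⟫ +
      ⟪(o z).2 - (o z').2, (z.2 : F) - z'.2⟫ := by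
  obtain ⟨x, y⟩ := z
  obtain ⟨x', y'⟩ := z'
  have h1 := h.convex x x' y
  have h2 := h.convex x' x y'
  have h3 := h.concave x y y'
  have h4 := h.concave x' y' y
  rw [norm_sub_rev] at h1 h3
  simp only [wdist, inner_sub_left, inner_sub_right] at *
  linarith

theorem swap (h : SaddleOracle X Y a b Lx Ly Lxy f o) :
    SaddleOracle Y X b a Ly Lx Lxy (fun y x => -f x y) (fun q => (o q.swap).swap) where
  convex y y' x := by have := h.concave x y y'; simp only [Prod.swap]; linarith
  concave y x x' := by have := h.convex x x' y; simp only [Prod.swap]; linarith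
  lip_x y y' x := h.lip_y x y y'
  lip_y y x x' := h.lip_x x x' y
  lip_xy y x x' := h.lip_yx x x' y
  lip_yx y y' x := h.lip_xy x y y'

/-- Adding the proximal term `β / 2 * ‖x - v‖ ^ 2` to the objective. -/
theorem add_prox (h : SaddleOracle X Y a b Lx Ly Lxy f o) {β : ℝ} (hβ : 0 ≤ β) (v : E) :
    SaddleOracle X Y (a + β) b (Lx + β) Ly Lxy (fun x y => f x y + β / 2 * ‖(x : E) - v‖ ^ 2)
      (fun q => ((o q).1 + β • ((q.1 : E) - v), (o q).2)) where
  convex x x' y := by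
    have h1 := h.convex x x' y
    have e : ‖(x' : E) - v‖ ^ 2
        = ‖(x' : E) - x‖ ^ 2 + 2 * ⟪(x : E) - v, (x' : E) - x⟫ + ‖(x : E) - v‖ ^ 2 := by
      rw [show (x' : E) - v = ((x' : E) - x) + ((x : E) - v) by abel, norm_add_sq_real,
        real_inner_comm]
    simp only [inner_add_left, inner_smul_left, conj_trivial]
    rw [e]
    linarith
  concave x y y' := by have := h.concave x y y'; linarith
  lip_x x x' y := by
    rw [show (o (x, y)).1 + β • ((x : E) - v) - ((o (x', y)).1 + β • ((x' : E) - v))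
      = ((o (x, y)).1 - (o (x', y)).1) + β • ((x : E) - x') by module]
    refine (norm_add_le _ _).trans ?_
    rw [norm_smul, Real.norm_of_nonneg hβ, add_mul]
    gcongr
    exact h.lip_x x x' y
  lip_y := h.lip_y
  lip_xy x y y' := by
    rw [add_sub_add_right_eq_sub]
    exact h.lip_xy x y y'
  lip_yx := h.lip_yx

/-- Convexity at the reversed pair and the Lipschitz bound replace integration along the segment.
The price is `Lx` instead of `Lx / 2`, so the smoothness moduli used below are `2 * Lx` and `2 *
Ly`. -/
theorem smooth_x (h : SaddleOracle X Y a b Lx Ly Lxy f o) (ha : 0 ≤ a) (x x' : X) (y : Y) :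
    f x' y ≤ f x y + ⟪(o (x, y)).1, (x' : E) - x⟫ + Lx * ‖(x' : E) - x‖ ^ 2 := by
  have h1 := h.convex x' x y
  have h2 := real_inner_le_norm ((o (x', y)).1 - (o (x, y)).1) ((x' : E) - x)
  have h3 := mul_le_mul_of_nonneg_right (h.lip_x x' x y) (norm_nonneg ((x' : E) - x))
  have h4 : 0 ≤ a / 2 * ‖(x : E) - x'‖ ^ 2 := by positivity
  have h5 : ⟪(o (x', y)).1, (x : E) - x'⟫ = - ⟪(o (x', y)).1, (x' : E) - x⟫ := by
    rw [← inner_neg_right, neg_sub]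
  rw [inner_sub_left] at h2
  nlinarith

/-- In the Hilbert sum both conditions form one variational inequality with modulus `min a b`. Test
points that change one coordinate only separate them again. -/
theorem exists_isSaddle [CompleteSpace E] [CompleteSpace F]
    (h : SaddleOracle X Y a b Lx Ly Lxy f o) (ha : 0 < a) (hb : 0 < b)
    (hX : X.Nonempty) (hXc : IsClosed X) (hX' : Convex ℝ X)
    (hY : Y.Nonempty) (hYc : IsClosed Y) (hY' : Convex ℝ Y) : ∃ z, IsSaddle o z := by
  let H := WithLp 2 (E × F)
  let K : Set H := {z | z.fst ∈ X ∧ z.snd ∈ Y}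
  let pr : K → X × Y := fun z => (⟨z.1.fst, z.2.1⟩, ⟨z.1.snd, z.2.2⟩)
  let G : K → H := fun z => WithLp.toLp 2 (o (pr z))
  have hKne : K.Nonempty := by
    obtain ⟨x, hx⟩ := hX
    obtain ⟨y, hy⟩ := hY
    exact ⟨WithLp.toLp 2 (x, y), hx, hy⟩
  have hKc : IsClosed K := by
    refine IsClosed.inter (hXc.preimage ?_) (hYc.preimage ?_)
    · exact WithLp.continuous_fst 2 E F
    · exact WithLp.continuous_snd 2 E F
  have hK : Convex ℝ K := by
    intro z hz w hw s t hs ht hst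
    exact ⟨hX' hz.1 hw.1 hs ht hst, hY' hz.2 hw.2 hs ht hst⟩
  have hmono : ∀ u v : K, min a b * ‖(u : H) - v‖ ^ 2 ≤ ⟪G u - G v, (u : H) - v⟫ := by
    intro u v
    have := h.strongly_monotone (pr u) (pr v)
    rw [WithLp.prod_inner_apply, WithLp.prod_norm_sq_eq_of_L2, mul_add]
    refine le_trans ?_ this
    exact add_le_add (mul_le_mul_of_nonneg_right (min_le_left _ _) (sq_nonneg _))
      (mul_le_mul_of_nonneg_right (min_le_right _ _) (sq_nonneg _))
  have hfst : ∀ z : H, ‖z.fst‖ ≤ ‖z‖ := fun z => by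
    refine abs_le_of_sq_le_sq' ?_ (norm_nonneg _) |>.2
    rw [WithLp.prod_norm_sq_eq_of_L2]
    nlinarith [sq_nonneg ‖z.snd‖]
  have hsnd : ∀ z : H, ‖z.snd‖ ≤ ‖z‖ := fun z => by
    refine abs_le_of_sq_le_sq' ?_ (norm_nonneg _) |>.2
    rw [WithLp.prod_norm_sq_eq_of_L2]
    nlinarith [sq_nonneg ‖z.fst‖]
  have hle : ∀ z : H, ‖z‖ ≤ ‖z.fst‖ + ‖z.snd‖ := fun z => by
    refine abs_le_of_sq_le_sq' ?_ (by positivity) |>.2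
    rw [WithLp.prod_norm_sq_eq_of_L2]
    nlinarith [norm_nonneg z.fst, norm_nonneg z.snd]
  have hlip : ∀ u v : K, ‖G u - G v‖ ≤ (|Lx| + |Lxy| + (|Lxy| + |Ly|)) * ‖(u : H) - v‖ := by
    intro u v
    have aux : ∀ c s t : ℝ, 0 ≤ s → s ≤ t → c * s ≤ |c| * t := fun c s t hs hst =>
      (mul_le_mul_of_nonneg_right (le_abs_self c) hs).trans
        (mul_le_mul_of_nonneg_left hst (abs_nonneg c))
    have hu := hfst ((u : H) - v)
    have hv := hsnd ((u : H) - v)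
    have h1 := h.lip_x (pr u).1 (pr v).1 (pr u).2
    have h2 := h.lip_xy (pr v).1 (pr u).2 (pr v).2
    have h3 := h.lip_yx (pr u).1 (pr v).1 (pr u).2
    have h4 := h.lip_y (pr v).1 (pr u).2 (pr v).2
    have h5 := norm_sub_le_norm_sub_add_norm_sub (o (pr u)).1 (o ((pr v).1, (pr u).2)).1 (o (pr v)).1
    have h6 := norm_sub_le_norm_sub_add_norm_sub (o (pr u)).2 (o ((pr v).1, (pr u).2)).2 (o (pr v)).2
    refine (hle _).trans ?_
    have e1 : (G u - G v).fst = (o (pr u)).1 - (o (pr v)).1 := rfl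
    have e2 : (G u - G v).snd = (o (pr u)).2 - (o (pr v)).2 := rfl
    rw [e1, e2]
    have g1 := h1.trans (aux _ _ _ (norm_nonneg _) hu)
    have g2 := h2.trans (aux _ _ _ (norm_nonneg _) hv)
    have g3 := h3.trans (aux _ _ _ (norm_nonneg _) hu)
    have g4 := h4.trans (aux _ _ _ (norm_nonneg _) hv)
    have k1 := h5.trans (add_le_add g1 g2)
    have k2 := h6.trans (add_le_add g3 g4)
    linarith
  obtain ⟨z, hz⟩ := exists_variationalInequality hKne hKc hK G (lt_min ha hb) hmono hlip
  refine ⟨pr z, fun x => ?_, fun y => ?_⟩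
  · have h0 := hz ⟨WithLp.toLp 2 ((x : E), z.1.snd), x.2, z.2.2⟩
    rw [WithLp.prod_inner_apply] at h0
    have h1 : 0 ≤ ⟪(o (pr z)).1, (x : E) - (pr z).1⟫ + ⟪(o (pr z)).2, z.1.snd - z.1.snd⟫ := h0
    simpa using h1
  · have h0 := hz ⟨WithLp.toLp 2 (z.1.fst, (y : F)), z.2.1, y.2⟩
    rw [WithLp.prod_inner_apply] at h0
    have h1 : 0 ≤ ⟪(o (pr z)).1, z.1.fst - z.1.fst⟫ + ⟪(o (pr z)).2, (y : F) - (pr z).2⟫ := h0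
    simpa using h1

end SaddleOracle

end VariationalInequality

/-! ### Accelerated gradient descent. -/

section Acceleration

variable {E F : Type} [NormedAddCommGroup E] [InnerProductSpace ℝ E]
  [NormedAddCommGroup F] [InnerProductSpace ℝ F]

theorem two_inner_sub_sub (p q r : E) :
    2 * ⟪p - q, r - p⟫ = ‖r - q‖ ^ 2 - ‖p - q‖ ^ 2 - ‖r - p‖ ^ 2 := by
  rw [show r - q = (p - q) + (r - p) by abel, norm_add_sq_real]
  ring

/-- One step of the accelerated gradient method with an inexact gradient `G + e`. -/
theorem accelerated_step {x z zp y xp w xs G e : E} {τ m M gx gy gxp gs : ℝ}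
    (hτ : 0 < τ) (hτ1 : τ ≤ 1) (hm : 0 ≤ m) (hM : M * τ ^ 2 = m)
    (hy : (1 + τ) • y = x + τ • z) (hxp : xp = (1 - τ) • x + τ • zp)
    (hw : w = τ • y + (1 - τ) • z)
    (hsmooth : gxp ≤ gy + ⟪G, xp - y⟫ + M / 2 * ‖xp - y‖ ^ 2)
    (hconvex : gy + ⟪G, x - y⟫ ≤ gx)
    (hstrong : gy + ⟪G, xs - y⟫ + m / 2 * ‖xs - y‖ ^ 2 ≤ gs)
    (hopt : 0 ≤ ⟪τ • (G + e) + m • (zp - w), xs - zp⟫) :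
    gxp - gs + m / 2 * ‖zp - xs‖ ^ 2 ≤
      (1 - τ) * (gx - gs + m / 2 * ‖z - xs‖ ^ 2) + τ * ⟪e, xs - zp⟫ := by
  -- The factor τ gained here, convexity of the squared norm and `M * τ ^ 2 = m` turn the smoothness
  -- error into exactly the squares that the three-point identities for `zp` subtract.
  have hxpy : xp - y = τ • (τ • (zp - y) + (1 - τ) • (zp - z)) := by
    have : τ • ((1 - τ) • z) = (1 - τ) • ((1 + τ) • y - x) := by rw [hy]; module
    have h2 : τ • (τ • (zp - y) + (1 - τ) • (zp - z))
        = τ • zp - (τ * τ) • y - τ • ((1 - τ) • z) := by module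
    rw [h2, this, hxp]
    module
  have hn1 : ‖xp - y‖ ^ 2 ≤ τ ^ 2 * (τ * ‖zp - y‖ ^ 2 + (1 - τ) * ‖zp - z‖ ^ 2) := by
    rw [hxpy, norm_smul, mul_pow, Real.norm_of_nonneg hτ.le]
    refine mul_le_mul_of_nonneg_left ?_ (sq_nonneg τ)
    rw [norm_add_sq_real, norm_smul, norm_smul, mul_pow, mul_pow, Real.norm_of_nonneg hτ.le,
      Real.norm_of_nonneg (sub_nonneg.2 hτ1), inner_smul_left, inner_smul_right]
    simp only [conj_trivial]
    have h0 : 0 ≤ ‖(zp - y) - (zp - z)‖ ^ 2 := sq_nonneg _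
    rw [norm_sub_sq_real] at h0
    have := mul_nonneg (mul_nonneg hτ.le (sub_nonneg.2 hτ1)) h0
    nlinarith
  have hG : ⟪G, xp - y⟫ = (1 - τ) * ⟪G, x - y⟫ + τ * (⟪G, xs - y⟫ - ⟪G, xs - zp⟫) := by
    rw [hxp, ← inner_sub_right, ← inner_smul_right, ← inner_smul_right, ← inner_add_right]
    congr 1
    module
  have hopt' : 0 ≤ τ * (⟪G, xs - zp⟫ + ⟪e, xs - zp⟫)
      + m * (τ * ⟪zp - y, xs - zp⟫ + (1 - τ) * ⟪zp - z, xs - zp⟫) := by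
    have e1 : m • (zp - w) = m • (τ • (zp - y) + (1 - τ) • (zp - z)) := by rw [hw]; module
    rw [e1] at hopt
    simpa only [inner_add_left, inner_smul_left, conj_trivial] using hopt
  have t1 := two_inner_sub_sub zp y xs
  have t2 := two_inner_sub_sub zp z xs
  rw [norm_sub_rev zp xs, norm_sub_rev z xs]
  have hM0 : 0 ≤ M := by
    by_contra! h
    nlinarith [mul_neg_of_neg_of_pos h (pow_pos hτ 2)]
  have s1 := mul_le_mul_of_nonneg_left hn1 (by positivity : 0 ≤ M / 2)
  have e3 : M / 2 * (τ ^ 2 * (τ * ‖zp - y‖ ^ 2 + (1 - τ) * ‖zp - z‖ ^ 2))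
      = m / 2 * (τ * ‖zp - y‖ ^ 2 + (1 - τ) * ‖zp - z‖ ^ 2) := by rw [← hM]; ring
  rw [e3] at s1
  have s2 := mul_le_mul_of_nonneg_left hconvex (sub_nonneg.2 hτ1)
  have s3 := mul_le_mul_of_nonneg_left hstrong hτ.le
  have e4 : ⟪zp - y, xs - zp⟫ = (‖xs - y‖ ^ 2 - ‖zp - y‖ ^ 2 - ‖xs - zp‖ ^ 2) / 2 := by linarith
  have e5 : ⟪zp - z, xs - zp⟫ = (‖xs - z‖ ^ 2 - ‖zp - z‖ ^ 2 - ‖xs - zp‖ ^ 2) / 2 := by linarith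
  rw [e4, e5] at hopt'
  rw [hG] at hsmooth
  linarith

/-- The accelerated gradient method for a smooth strongly convex function on a closed convex
set, with a contraction estimate for the distance to the minimizer. -/
theorem exists_accelerated_minimizer [CompleteSpace E] {X : Set E} (hXc : IsClosed X)
    (hX : Convex ℝ X) {a M : ℝ} (ha : 0 < a) (haM : a ≤ M) (k : ℕ) :
    ∃ S : (X → E) → X → X, (∀ x, ComputableWithin (k + 1) (fun G => S G x)) ∧
      ∀ (g : X → ℝ) (G : X → E),
        (∀ x x' : X, g x + ⟪G x, (x' : E) - x⟫ + a / 2 * ‖(x' : E) - x‖ ^ 2 ≤ g x') →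
        (∀ x x' : X, g x' ≤ g x + ⟪G x, (x' : E) - x⟫ + M / 2 * ‖(x' : E) - x‖ ^ 2) →
        ∀ xs : X, (∀ x : X, 0 ≤ ⟪G xs, (x : E) - xs⟫) → ∀ x : X,
          ‖(S G x : E) - xs‖ ^ 2 ≤ M / a * (1 - √(a / M)) ^ k * ‖(x : E) - xs‖ ^ 2 := by
  obtain rfl | hne := X.eq_empty_or_nonempty
  · exact ⟨fun _ x => x, fun x => x.2.elim, fun _ _ _ _ xs => xs.2.elim⟩
  obtain ⟨P, hP⟩ := exists_projection hne hXc hX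
  have hM : 0 < M := ha.trans_le haM
  set τ := √(a / M) with hτdef
  have hτ : 0 < τ := Real.sqrt_pos.2 (by positivity)
  have hτ2 : τ ^ 2 = a / M := Real.sq_sqrt (by positivity)
  have hτ1 : τ ≤ 1 := Real.sqrt_le_one.2 ((div_le_one hM).2 haM)
  have hMτ : M * τ ^ 2 = a := by rw [hτ2]; field_simp
  let mid : X → X → X := fun x z => ⟨(1 + τ)⁻¹ • (x : E) + (τ * (1 + τ)⁻¹) • (z : E),
    hX x.2 z.2 (by positivity) (by positivity) (by field_simp)⟩
  let avg : X → X → X := fun x z => ⟨(1 - τ) • (x : E) + τ • (z : E),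
    hX x.2 z.2 (sub_nonneg.2 hτ1) hτ.le (by ring)⟩
  let next : X × X → E → X × X := fun s G =>
    let zp := P (τ • (mid s.1 s.2 : E) + (1 - τ) • (s.2 : E) - (τ / a) • G)
    (avg s.1 zp, zp)
  let step : (X → E) → X × X → X × X := fun G s => next s (G (mid s.1 s.2))
  -- This projected step is the extra query in `k + 1`. It is needed because the gradient at a
  -- constrained minimizer may be nonzero, so `g x - g xs` itself is not bounded by the squared
  -- distance.
  let init : X → E → X × X := fun x G => (P ((x : E) - M⁻¹ • G), P ((x : E) - M⁻¹ • G))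
  refine ⟨fun G x => ((step G)^[k] (init x (G x))).2, fun x => ?_, ?_⟩
  · have h1 : ComputableWithin 1 (fun G : X → E => init x (G x)) :=
      (ComputableWithin.query x).map (init x)
    have h2 : ∀ s, ComputableWithin 1 (fun G : X → E => step G s) := fun s =>
      (ComputableWithin.query (mid s.1 s.2)).map (next s)
    have h3 := h1.bind (s := fun s G => (step G)^[k] s) (fun s => ComputableWithin.iterate h2 k s)
    exact (h3.map Prod.snd).mono (by omega)
  · intro g G hg hg' xs hxs x
    let Φ : X × X → ℝ := fun s => g s.1 - g xs + a / 2 * ‖(s.2 : E) - xs‖ ^ 2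
    have hstep : ∀ s, Φ (step G s) ≤ (1 - τ) * Φ s := by
      intro s
      set y := mid s.1 s.2 with hy
      set w := τ • (y : E) + (1 - τ) • (s.2 : E) with hw
      set zp := P (w - (τ / a) • G y) with hzp
      have hyE : (1 + τ) • (y : E) = s.1 + τ • (s.2 : E) := by
        change (1 + τ) • ((1 + τ)⁻¹ • (s.1 : E) + (τ * (1 + τ)⁻¹) • (s.2 : E)) = _
        rw [smul_add, smul_smul, smul_smul, mul_inv_cancel₀ (by positivity), one_smul]
        congr 2
        field_simp
      have hopt : 0 ≤ ⟪τ • (G y + 0) + a • ((zp : E) - w), (xs : E) - zp⟫ := by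
        have h1 := mul_nonpos_of_nonneg_of_nonpos ha.le (hP (w - (τ / a) • G y) xs)
        rw [← hzp, ← real_inner_smul_left] at h1
        have e : τ • (G y + 0) + a • ((zp : E) - w) = -(a • (w - (τ / a) • G y - zp)) := by
          have : a • ((τ / a) • G y) = τ • G y := by
            rw [smul_smul, mul_div_cancel₀ _ ha.ne']
          rw [smul_sub, smul_sub, smul_sub, this]
          module
        rw [e, inner_neg_left]
        linarith
      have h0 := hg y s.1
      have h00 : 0 ≤ a / 2 * ‖(s.1 : E) - y‖ ^ 2 := by positivity
      have := accelerated_step (xp := (avg s.1 zp : E)) hτ hτ1 ha.le hMτ hyE rfl hw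
        (hg' y (avg s.1 zp)) (by linarith : g y + ⟪G y, (s.1 : E) - y⟫ ≤ g s.1) (hg y xs) hopt
      simpa [Φ] using this
    have hiter : ∀ s, Φ ((step G)^[k] s) ≤ (1 - τ) ^ k * Φ s := by
      intro s
      induction k with
      | zero => simp
      | succ k ih =>
        rw [Function.iterate_succ_apply', pow_succ']
        refine (hstep _).trans ?_
        rw [mul_assoc]
        exact mul_le_mul_of_nonneg_left ih (sub_nonneg.2 hτ1)
    have hinit : Φ (init x (G x)) ≤ M / 2 * ‖(x : E) - xs‖ ^ 2 := by
      set p := P ((x : E) - M⁻¹ • G x) with hp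
      have h1 := mul_nonpos_of_nonneg_of_nonpos hM.le (hP ((x : E) - M⁻¹ • G x) xs)
      rw [← hp, ← real_inner_smul_left,
        show M • ((x : E) - M⁻¹ • G x - p) = -(M • ((p : E) - x) + G x) by
          rw [smul_sub, smul_sub, smul_smul, mul_inv_cancel₀ hM.ne']; module,
        inner_neg_left, inner_add_left, real_inner_smul_left] at h1
      have h2 := two_inner_sub_sub (p : E) x xs
      have h3 := hg' x p
      have h4 := hg x xs
      have h5 : ⟪G x, (p : E) - x⟫ = ⟪G x, (xs : E) - x⟫ - ⟪G x, (xs : E) - p⟫ := by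
        rw [← inner_sub_right]; congr 1; abel
      have h6 : 0 ≤ a / 2 * ‖(xs : E) - x‖ ^ 2 := by positivity
      have h7 : a / 2 * ‖(p : E) - xs‖ ^ 2 ≤ M / 2 * ‖(p : E) - xs‖ ^ 2 := by gcongr
      change g p - g xs + a / 2 * ‖(p : E) - xs‖ ^ 2 ≤ _
      rw [norm_sub_rev (p : E) xs] at *
      rw [norm_sub_rev (x : E) xs]
      have h8 : ⟪(p : E) - x, (xs : E) - p⟫
        = (‖(xs : E) - x‖ ^ 2 - ‖(p : E) - x‖ ^ 2 - ‖(xs : E) - p‖ ^ 2) / 2 := by linarith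
      rw [h8] at h1
      linarith
    set s := (step G)^[k] (init x (G x)) with hs
    have h1 : a / 2 * ‖(s.2 : E) - xs‖ ^ 2 ≤ Φ s := by
      have h2 := hg xs s.1
      have h3 : 0 ≤ a / 2 * ‖(s.1 : E) - xs‖ ^ 2 := by positivity
      have h4 := hxs s.1
      change _ ≤ g s.1 - g xs + a / 2 * ‖(s.2 : E) - xs‖ ^ 2
      linarith
    have h2 := (h1.trans (hiter _)).trans
      (mul_le_mul_of_nonneg_left hinit (pow_nonneg (sub_nonneg.2 hτ1) k))
    have h3 := mul_le_mul_of_nonneg_left h2 (by positivity : 0 ≤ 2 / a)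
    have e1 : 2 / a * (a / 2 * ‖(s.2 : E) - xs‖ ^ 2) = ‖(s.2 : E) - xs‖ ^ 2 := by field_simp
    have e2 : 2 / a * ((1 - τ) ^ k * (M / 2 * ‖(x : E) - xs‖ ^ 2))
      = M / a * (1 - τ) ^ k * ‖(x : E) - xs‖ ^ 2 := by field_simp
    rw [e1, e2] at h3
    exact h3

end Acceleration

/-! ### Weakly coupled problems: best responses. -/

section Solvers

variable {E F : Type} [NormedAddCommGroup E] [InnerProductSpace ℝ E]
  [NormedAddCommGroup F] [InnerProductSpace ℝ F]

/-- Some method reduces the weighted squared distance to the saddle point by the factor `δ`, on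
every problem with the given moduli, with at most `N` oracle calls. -/
def ReducesWithin (X : Set E) (Y : Set F) (a b Lx Ly Lxy : ℝ) (N : ℕ) (δ : ℝ) : Prop :=
  ∃ S : (X × Y → E × F) → X × Y → X × Y, (∀ z, ComputableWithin N (fun o => S o z)) ∧
    ∀ f o, SaddleOracle X Y a b Lx Ly Lxy f o → ∀ zs, IsSaddle o zs →
      ∀ z, wdist a b (S o z) zs ≤ δ * wdist a b z zs

theorem IsSaddle.swap {X : Set E} {Y : Set F} {o : X × Y → E × F} {z : X × Y}
    (h : IsSaddle o z) : IsSaddle (fun q : Y × X => (o q.swap).swap) z.swap := ⟨h.2, h.1⟩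

theorem ReducesWithin.swap {X : Set E} {Y : Set F} {a b Lx Ly Lxy δ : ℝ} {N : ℕ}
    (h : ReducesWithin X Y a b Lx Ly Lxy N δ) : ReducesWithin Y X b a Ly Lx Lxy N δ := by
  obtain ⟨S, hS, hS'⟩ := h
  refine ⟨fun o z => (S (fun q => (o q.swap).swap) z.swap).swap, fun z => ?_, ?_⟩
  · exact ((hS z.swap).translate (fun _ => Prod.swap) Prod.swap).map Prod.swap
  · intro f o ho zs hzs z
    have := hS' _ _ ho.swap zs.swap hzs.swap z.swap
    rw [wdist_swap] at this
    rw [← wdist_swap]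
    exact this

/-- Let D = a r². The exact best response `xh` depends on `y` with Lipschitz constant `Lxy / a`, so
weak coupling puts it within r/2 of the saddle point. The inexact one errs by at most 1/8 of ‖x -
xh‖ ≤ 3r/2. Together this is 11r/16 ≤ 3r/4, whose square gives 9/16. -/
theorem best_response_step [CompleteSpace E] {X : Set E} {Y : Set F} {a b Lx Ly Lxy : ℝ}
    {f : X → Y → ℝ} {o : X × Y → E × F} (h : SaddleOracle X Y a b Lx Ly Lxy f o)
    (ha : 0 < a) (hL : 4 * Lxy ^ 2 ≤ a * b) (hXc : IsClosed X) (hX : Convex ℝ X)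
    {zs : X × Y} (hzs : IsSaddle o zs) {x x' : X} {y : Y}
    (hx' : ∀ xh : X, (∀ u : X, 0 ≤ ⟪(o (xh, y)).1, (u : E) - xh⟫) →
      ‖(x' : E) - xh‖ ^ 2 ≤ 1 / 64 * ‖(x : E) - xh‖ ^ 2)
    {D : ℝ} (hxD : a * ‖(x : E) - zs.1‖ ^ 2 ≤ D) (hyD : b * ‖(y : F) - zs.2‖ ^ 2 ≤ D) :
    a * ‖(x' : E) - zs.1‖ ^ 2 ≤ 9 / 16 * D := by
  have hmono : ∀ u v : X, a * ‖(u : E) - v‖ ^ 2 ≤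
      ⟪(o (u, y)).1 - (o (v, y)).1, (u : E) - v⟫ := fun u v => by
    have := h.strongly_monotone (u, y) (v, y)
    simpa [wdist] using this
  obtain ⟨xh, hxh⟩ := exists_variationalInequality ⟨_, x.2⟩ hXc hX (fun u => (o (u, y)).1) ha
    hmono (fun u v => h.lip_x u v y)
  have h1 := hx' xh hxh
  have h2 : a * ‖(xh : E) - zs.1‖ ≤ Lxy * ‖(y : F) - zs.2‖ := by
    have g1 := hmono xh zs.1
    have g2 := hxh zs.1
    have g3 := hzs.1 xh
    have g4 := real_inner_le_norm ((o zs).1 - (o (zs.1, y)).1) ((xh : E) - zs.1)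
    have g5 := mul_le_mul_of_nonneg_right (h.lip_xy zs.1 zs.2 y) (norm_nonneg ((xh : E) - zs.1))
    rw [← neg_sub (xh : E), inner_neg_right] at g2
    rw [inner_sub_left] at g1 g4
    have g6 : a * ‖(xh : E) - zs.1‖ ^ 2 ≤ Lxy * ‖(zs.2 : F) - y‖ * ‖(xh : E) - zs.1‖ := by
      have e : (o (zs.1, zs.2)) = o zs := rfl
      rw [e] at g5
      linarith
    rw [norm_sub_rev (y : F)]
    rcases (norm_nonneg ((xh : E) - zs.1)).eq_or_lt with h0 | h0
    · rw [← h0, mul_zero]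
      have g7 := (norm_nonneg _).trans (h.lip_xy zs.1 zs.2 y)
      exact g7
    · refine le_of_mul_le_mul_right ?_ h0
      nlinarith
  have hD : 0 ≤ D := le_trans (by positivity) hxD
  set r := √(D / a) with hr
  have hr2 : a * r ^ 2 = D := by rw [hr, Real.sq_sqrt (by positivity)]; field_simp
  have hr0 : 0 ≤ r := Real.sqrt_nonneg _
  have h3 : ‖(x : E) - zs.1‖ ≤ r := by
    refine abs_le_of_sq_le_sq' (le_of_mul_le_mul_left ?_ ha) hr0 |>.2
    rw [hr2]; exact hxD
  have h4 : ‖(xh : E) - zs.1‖ ≤ r / 2 := by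
    refine abs_le_of_sq_le_sq' (le_of_mul_le_mul_left ?_ (mul_pos ha ha)) (by positivity) |>.2
    have h5 : (a * ‖(xh : E) - zs.1‖) ^ 2 ≤ (Lxy * ‖(y : F) - zs.2‖) ^ 2 :=
      pow_le_pow_left₀ (by positivity) h2 2
    have h6 := mul_le_mul_of_nonneg_right hL (sq_nonneg ‖(y : F) - zs.2‖)
    have h7 := mul_le_mul_of_nonneg_left hyD ha.le
    rw [← hr2] at h7
    nlinarith
  have h5 : ‖(x' : E) - xh‖ ≤ 1 / 8 * ‖(x : E) - xh‖ := by
    refine abs_le_of_sq_le_sq' ?_ (by positivity) |>.2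
    rw [mul_pow]; norm_num at *; exact h1
  have h6 := norm_sub_le_norm_sub_add_norm_sub (x' : E) xh zs.1
  have h7 := norm_sub_le_norm_sub_add_norm_sub (x : E) zs.1 xh
  rw [norm_sub_rev (zs.1 : E)] at h7
  have h8 : ‖(x' : E) - zs.1‖ ≤ 3 / 4 * r := by linarith
  have h9 : ‖(x' : E) - zs.1‖ ^ 2 ≤ (3 / 4 * r) ^ 2 := pow_le_pow_left₀ (norm_nonneg _) h8 2
  have h10 := mul_le_mul_of_nonneg_left h9 ha.le
  rw [← hr2]
  linarith

/-- Alternating best responses solve weakly coupled problems. -/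
theorem ReducesWithin.of_weak_coupling [CompleteSpace E] [CompleteSpace F] {X : Set E} {Y : Set F}
    (hXc : IsClosed X) (hX : Convex ℝ X) (hYc : IsClosed Y) (hY : Convex ℝ Y)
    {a b Lx Ly Lxy δ : ℝ} (ha : 0 < a) (hb : 0 < b) (haL : a ≤ 2 * Lx) (hbL : b ≤ 2 * Ly)
    (hL : 4 * Lxy ^ 2 ≤ a * b) {k kx ky : ℕ}
    (hkx : 2 * Lx / a * (1 - √(a / (2 * Lx))) ^ kx ≤ 1 / 64)
    (hky : 2 * Ly / b * (1 - √(b / (2 * Ly))) ^ ky ≤ 1 / 64)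
    (hk : 2 * (9 / 16 : ℝ) ^ k ≤ δ) :
    ReducesWithin X Y a b Lx Ly Lxy (k * ((kx + 1) + (ky + 1))) δ := by
  obtain ⟨Sx, hSx, hSx'⟩ := exists_accelerated_minimizer hXc hX ha haL kx
  obtain ⟨Sy, hSy, hSy'⟩ := exists_accelerated_minimizer hYc hY hb hbL ky
  -- Both players answer the old point, so the estimate for y is the one for x with the players
  -- exchanged.
  let step : (X × Y → E × F) → X × Y → X × Y := fun o z =>
    (Sx (fun x => (o (x, z.2)).1) z.1, Sy (fun y => (o (z.1, y)).2) z.2)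
  refine ⟨fun o z => (step o)^[k] z, fun z => ComputableWithin.iterate (fun s => ?_) k z, ?_⟩
  · have h1 : ComputableWithin (kx + 1)
        (fun o : X × Y → E × F => Sx (fun x => (o (x, s.2)).1) s.1) :=
      (hSx s.1).translate (fun _ => Prod.fst) (fun x => (x, s.2))
    have h2 : ComputableWithin (ky + 1)
        (fun o : X × Y → E × F => Sy (fun y => (o (s.1, y)).2) s.2) :=
      (hSy s.2).translate (fun _ => Prod.snd) (fun y => (s.1, y))
    exact h1.bind (s := fun x o => (x, Sy (fun y => (o (s.1, y)).2) s.2))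
      fun x => h2.map (Prod.mk x)
  · intro f o ho zs hzs z
    -- The maximum contracts; passing back to the sum `wdist` costs the factor 2 in `hk`.
    let D : X × Y → ℝ := fun z => max (a * ‖(z.1 : E) - zs.1‖ ^ 2) (b * ‖(z.2 : F) - zs.2‖ ^ 2)
    have hstep : ∀ s, D (step o s) ≤ 9 / 16 * D s := by
      intro s
      refine max_le ?_ ?_
      · refine best_response_step ho ha hL hXc hX hzs (x := s.1) (y := s.2) (fun xh hxh => ?_)
          (le_max_left _ _) (le_max_right _ _)
        refine (hSx' (fun x => f x s.2) (fun x => (o (x, s.2)).1)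
          (fun x x' => ho.convex x x' s.2) (fun x x' => ?_) xh hxh s.1).trans
          (mul_le_mul_of_nonneg_right hkx (sq_nonneg _))
        have := ho.smooth_x ha.le x x' s.2
        linarith
      · refine best_response_step ho.swap hb (by linarith) hYc hY hzs.swap (x := s.2) (y := s.1)
          (fun yh hyh => ?_) (le_max_right _ _) (le_max_left _ _)
        refine (hSy' (fun y => -f s.1 y) (fun y => (o (s.1, y)).2)
          (fun y y' => ho.swap.convex y y' s.1) (fun y y' => ?_) yh hyh s.2).trans
          (mul_le_mul_of_nonneg_right hky (sq_nonneg _))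
        have := ho.swap.smooth_x hb.le y y' s.1
        simp only [Prod.swap] at this
        linarith
    have hiter : ∀ j, D ((step o)^[j] z) ≤ (9 / 16) ^ j * D z := by
      intro j
      induction j with
      | zero => simp
      | succ j ih =>
        rw [Function.iterate_succ_apply', pow_succ', mul_assoc]
        exact (hstep _).trans (mul_le_mul_of_nonneg_left ih (by norm_num))
    have hle : ∀ s, wdist a b s zs ≤ 2 * D s := fun s => by
      have h1 : a * ‖(s.1 : E) - zs.1‖ ^ 2 ≤ D s := le_max_left _ _
      have h2 : b * ‖(s.2 : F) - zs.2‖ ^ 2 ≤ D s := le_max_right _ _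
      unfold wdist
      linarith
    have hge : D z ≤ wdist a b z zs := by
      have h1 : 0 ≤ a * ‖(z.1 : E) - zs.1‖ ^ 2 := by positivity
      have h2 : 0 ≤ b * ‖(z.2 : F) - zs.2‖ ^ 2 := by positivity
      unfold wdist
      exact max_le (by linarith) (by linarith)
    have hw0 : 0 ≤ wdist a b z zs := by unfold wdist; positivity
    calc wdist a b ((step o)^[k] z) zs ≤ 2 * ((9 / 16) ^ k * D z) :=
          (hle _).trans (mul_le_mul_of_nonneg_left (hiter k) (by norm_num))
      _ ≤ 2 * ((9 / 16) ^ k * wdist a b z zs) := by gcongr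
      _ = 2 * (9 / 16) ^ k * wdist a b z zs := by ring
      _ ≤ δ * wdist a b z zs := mul_le_mul_of_nonneg_right hk hw0

end Solvers

/-! ### Accelerated inexact proximal point method on the Moreau envelope. -/

section ProximalAcceleration

variable {E F : Type} [NormedAddCommGroup E] [InnerProductSpace ℝ E]
  [NormedAddCommGroup F] [InnerProductSpace ℝ F]

/-- The saddle operator after adding `β / 2 * ‖x - v‖ ^ 2` to the objective. -/
def proxOracle {X : Set E} {Y : Set F} (o : X × Y → E × F) (β : ℝ) (v : E) : X × Y → E × F :=
  fun q => ((o q).1 + β • ((q.1 : E) - v), (o q).2)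

/-- The value of the objective with the proximal term `β / 2 * ‖x - v‖ ^ 2`. -/
noncomputable def proxValue {X : Set E} {Y : Set F} (f : X → Y → ℝ) (β : ℝ) (v : E) (z : X × Y) :
    ℝ :=
  f z.1 z.2 + β / 2 * ‖(z.1 : E) - v‖ ^ 2

variable {X : Set E} {Y : Set F} {a b Lx Ly Lxy β : ℝ} {f : X → Y → ℝ} {o : X × Y → E × F}

/-- Pass from `z` to `z'` through the mixed point `(z'.1, z.2)`: convexity and the saddle condition
at `z`, then concavity and the condition at `z'`. Keeping the displacement `z'.1 - z.1` explicit
yields both the strong convexity and the smoothness of the envelope, with gradient β(v - z.1). -/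
theorem proxValue_add_le (h : SaddleOracle X Y a b Lx Ly Lxy f o) (hβ : 0 ≤ β) (hb : 0 ≤ b)
    {v v' : E} {z z' : X × Y} (hz : IsSaddle (proxOracle o β v) z)
    (hz' : IsSaddle (proxOracle o β v') z') :
    proxValue f β v z + β * ⟪v - z.1, v' - v⟫ + (a + β) / 2 * ‖(z'.1 : E) - z.1‖ ^ 2
      + β / 2 * ‖v' - v‖ ^ 2 - β * ⟪(z'.1 : E) - z.1, v' - v⟫ ≤ proxValue f β v' z' := by
  have h1 := (h.add_prox hβ v').concave z'.1 z'.2 z.2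
  have h2 := (h.add_prox hβ v).convex z.1 z'.1 z.2
  have h3 : 0 ≤ ⟪(proxOracle o β v z).1, (z'.1 : E) - z.1⟫ := hz.1 z'.1
  have h4 : 0 ≤ ⟪(proxOracle o β v' z').2, (z.2 : F) - z'.2⟫ := hz'.2 z.2
  simp only [proxOracle] at h3 h4
  simp only [Prod.mk.eta] at h1 h2
  have h5 : 0 ≤ b / 2 * ‖(z.2 : F) - z'.2‖ ^ 2 := by positivity
  have e : ‖(z'.1 : E) - v'‖ ^ 2 - ‖(z'.1 : E) - v‖ ^ 2
      = ‖v' - v‖ ^ 2 + 2 * ⟪v - z.1, v' - v⟫ - 2 * ⟪(z'.1 : E) - z.1, v' - v⟫ := by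
    rw [show (z'.1 : E) - v' = (z'.1 - v) - (v' - v) by abel, norm_sub_sq_real,
      show (z'.1 : E) - v = ((z'.1 : E) - z.1) - (v - z.1) by abel]
    simp only [inner_sub_left]
    ring
  unfold proxValue
  nlinarith

/-- The Moreau envelope of the primal objective is strongly convex. -/
theorem proxValue_strongly_convex (h : SaddleOracle X Y a b Lx Ly Lxy f o) (ha : 0 < a)
    (hβ : 0 < β) (hb : 0 ≤ b) {v v' : E} {z z' : X × Y} (hz : IsSaddle (proxOracle o β v) z)
    (hz' : IsSaddle (proxOracle o β v') z') :
    proxValue f β v z + ⟪β • (v - z.1), v' - v⟫ + a * β / (a + β) / 2 * ‖v' - v‖ ^ 2 ≤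
      proxValue f β v' z' := by
  have h1 := proxValue_add_le h hβ.le hb hz hz'
  -- Completing the square in the displacement, with optimum β/(a+β) · (v' - v), leaves the modulus
  -- aβ/(a+β).
  have h2 : 0 ≤ ‖(a + β) • ((z'.1 : E) - z.1) - β • (v' - v)‖ ^ 2 := sq_nonneg _
  rw [norm_sub_sq_real, norm_smul, norm_smul, inner_smul_left, inner_smul_right, mul_pow, mul_pow,
    Real.norm_of_nonneg hβ.le, Real.norm_of_nonneg (by positivity : 0 ≤ a + β)] at h2
  simp only [conj_trivial] at h2
  have h3 := div_nonneg h2 (by positivity : 0 ≤ 2 * (a + β))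
  rw [real_inner_smul_left]
  have e : ((a + β) ^ 2 * ‖(z'.1 : E) - z.1‖ ^ 2
        - 2 * ((a + β) * (β * ⟪(z'.1 : E) - z.1, v' - v⟫)) + β ^ 2 * ‖v' - v‖ ^ 2) / (2 * (a + β))
      = (a + β) / 2 * ‖(z'.1 : E) - z.1‖ ^ 2 - β * ⟪(z'.1 : E) - z.1, v' - v⟫
        + β / 2 * ‖v' - v‖ ^ 2 - a * β / (a + β) / 2 * ‖v' - v‖ ^ 2 := by
    field_simp
    ring
  rw [e] at h3
  linarith

/-- The Moreau envelope of the primal objective is smooth. -/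
theorem proxValue_smooth (h : SaddleOracle X Y a b Lx Ly Lxy f o) (ha : 0 ≤ a)
    (hβ : 0 ≤ β) (hb : 0 ≤ b) {v v' : E} {z z' : X × Y} (hz : IsSaddle (proxOracle o β v) z)
    (hz' : IsSaddle (proxOracle o β v') z') :
    proxValue f β v' z' ≤
      proxValue f β v z + ⟪β • (v - z.1), v' - v⟫ + β / 2 * ‖v' - v‖ ^ 2 := by
  -- The same inequality with the centers exchanged; the squared displacement is then dropped.
  have h1 := proxValue_add_le h hβ hb hz' hz
  rw [real_inner_smul_left]
  have e1 : ⟪v' - z'.1, v - v'⟫ = -⟪v - z.1, v' - v⟫ + ⟪(z'.1 : E) - z.1, v' - v⟫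
      - ‖v' - v‖ ^ 2 := by
    rw [← real_inner_self_eq_norm_sq, ← neg_sub v' v, inner_neg_right, ← inner_neg_left,
      ← inner_neg_left, ← inner_add_left, ← inner_sub_left]
    congr 1
    abel
  have e2 : ⟪(z.1 : E) - z'.1, v - v'⟫ = ⟪(z'.1 : E) - z.1, v' - v⟫ := by
    rw [← neg_sub v' v, ← neg_sub (z'.1 : E), inner_neg_neg]
  have h2 : 0 ≤ (a + β) / 2 * ‖(z.1 : E) - z'.1‖ ^ 2 := by positivity
  rw [e1, e2, norm_sub_rev v v'] at h1
  linarith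

/-- The saddle point of the proximal problem depends continuously on the proximal center. -/
theorem wdist_prox_le (h : SaddleOracle X Y a b Lx Ly Lxy f o) (ha : 0 ≤ a)
    (hβ : 0 ≤ β) (hb : 0 ≤ b) {v v' : E} {z z' : X × Y} (hz : IsSaddle (proxOracle o β v) z)
    (hz' : IsSaddle (proxOracle o β v') z') :
    wdist (a + β) b z z' ≤ β * ‖v - v'‖ ^ 2 := by
  have h1 := (h.add_prox hβ v).strongly_monotone z z'
  have h2 := hz.1 z'.1
  have h3 := hz.2 z'.2
  have h4 := hz'.1 z.1
  have h5 := hz'.2 z.2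
  simp only [proxOracle] at h2 h3 h4 h5
  have e2 : ⟪(o z').1 + β • ((z'.1 : E) - v), (z.1 : E) - z'.1⟫
      = ⟪(o z').1 + β • ((z'.1 : E) - v'), (z.1 : E) - z'.1⟫ - β * ⟪v - v', (z.1 : E) - z'.1⟫ := by
    rw [← real_inner_smul_left, ← inner_sub_left]
    congr 1
    module
  rw [inner_sub_left, inner_sub_left, e2] at h1
  rw [← neg_sub (z.1 : E), inner_neg_right] at h2
  rw [← neg_sub (z.2 : F), inner_neg_right] at h3
  have h6 := real_inner_le_norm (v - v') ((z.1 : E) - z'.1)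
  have h7 : β * ‖(z.1 : E) - z'.1‖ ^ 2 ≤ wdist (a + β) b z z' := by
    have g1 : 0 ≤ a * ‖(z.1 : E) - z'.1‖ ^ 2 := by positivity
    have g2 : 0 ≤ b * ‖(z.2 : F) - z'.2‖ ^ 2 := by positivity
    unfold wdist
    linarith
  have h8 := mul_le_mul_of_nonneg_left h6 hβ
  have h9 := mul_nonneg hβ (sq_nonneg (‖v - v'‖ - ‖(z.1 : E) - z'.1‖))
  linarith

omit [InnerProductSpace ℝ F] [NormedAddCommGroup F] in
theorem norm_extrapolation_sub_sq_le (x z u : E) {τ : ℝ} (hτ : 0 ≤ τ) :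
    ‖(1 + τ)⁻¹ • (x + τ • z) - u‖ ^ 2 ≤ ‖x - u‖ ^ 2 + ‖z - u‖ ^ 2 := by
  have hθ : 0 < 1 + τ := by positivity
  have h1 : (1 + τ)⁻¹ • (x + τ • z) - u = (1 + τ)⁻¹ • ((x - u) + τ • (z - u)) := by
    have h2 : (x - u) + τ • (z - u) = (x + τ • z) - (1 + τ) • u := by module
    rw [h2, smul_sub, smul_smul, inv_mul_cancel₀ hθ.ne', one_smul]
  have h2 : ‖(x - u) + τ • (z - u)‖ ≤ ‖x - u‖ + τ * ‖z - u‖ := by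
    refine (norm_add_le _ _).trans_eq ?_
    rw [norm_smul, Real.norm_of_nonneg hτ]
  have h3 : ‖(x - u) + τ • (z - u)‖ ≤ (1 + τ) * max ‖x - u‖ ‖z - u‖ := by
    have g1 := le_max_left ‖x - u‖ ‖z - u‖
    have g2 := mul_le_mul_of_nonneg_left (le_max_right ‖x - u‖ ‖z - u‖) hτ
    linarith
  have h4 : ‖(1 + τ)⁻¹ • (x + τ • z) - u‖ ≤ max ‖x - u‖ ‖z - u‖ := by
    rw [h1, norm_smul, Real.norm_of_nonneg (inv_nonneg.2 hθ.le), inv_mul_le_iff₀ hθ]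
    exact h3
  rcases le_max_iff.1 h4 with h | h
  · have := pow_le_pow_left₀ (norm_nonneg _) h 2
    nlinarith [sq_nonneg ‖z - u‖]
  · have := pow_le_pow_left₀ (norm_nonneg _) h 2
    nlinarith [sq_nonneg ‖x - u‖]

omit [InnerProductSpace ℝ F] [NormedAddCommGroup F] in
theorem inner_le_sq_div_add (e u v : E) {m : ℝ} (hm : 0 < m) :
    ⟪e, u - v⟫ ≤ ‖e‖ ^ 2 / m + m / 4 * ‖v - u‖ ^ 2 := by
  have h1 := real_inner_le_norm e (u - v)
  have h2 : 0 ≤ (‖e‖ - m / 2 * ‖u - v‖) ^ 2 / m := by positivity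
  have h3 : (‖e‖ - m / 2 * ‖u - v‖) ^ 2 / m
    = ‖e‖ ^ 2 / m + m / 4 * ‖u - v‖ ^ 2 - ‖e‖ * ‖u - v‖ := by field_simp; ring
  rw [norm_sub_rev v]
  linarith

/-- Φ is the potential of the exact method and V the warm-start error. The term Φ'/2 is the part of
the gradient error absorbed on the left, leaving a decrease of about τΦ/2. The weight τ/32 is small
enough that the 4Φ in `V'` uses up only about τΦ/8 of it, and large enough to dominate the V in `e`.
-/
theorem accelerated_potential {τ Φ Φ' V V' e : ℝ} (hτ : 0 < τ) (hτ1 : τ ≤ 1)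
    (hΦ : 0 ≤ Φ) (hV : 0 ≤ V) (hΦ' : Φ' ≤ (1 - τ) * Φ + τ * (e + Φ' / 2))
    (he : e ≤ V / 128 + Φ / 64) (hV' : V' ≤ (2 * V + 4 * Φ) / 128 + 4 * Φ) :
    Φ' + τ * V' / 32 ≤ (1 - τ / 4) * (Φ + τ * V / 32) := by
  have h1 : Φ' ≤ (1 - τ / 2) * Φ + 2 * τ * (V / 128 + Φ / 64) := by
    have h2 : (1 - τ / 2) * Φ' ≤ (1 - τ / 2) * ((1 - τ / 2) * Φ + 2 * τ * (V / 128 + Φ / 64)) := by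
      have g1 := mul_le_mul_of_nonneg_left he hτ.le
      have g2 : 0 ≤ τ * (1 - τ) * (V / 128 + Φ / 64) :=
        mul_nonneg (mul_nonneg hτ.le (sub_nonneg.2 hτ1)) (by positivity)
      have g3 : 0 ≤ τ ^ 2 * Φ := by positivity
      nlinarith
    exact le_of_mul_le_mul_left h2 (by linarith)
  have h2 := mul_le_mul_of_nonneg_left hV' hτ.le
  have h3 : 0 ≤ τ * Φ := by positivity
  have h4 : 0 ≤ τ * V := by positivity
  have h5 : τ * (τ * V) ≤ τ * V := by nlinarith
  nlinarith

set_option maxHeartbeats 1000000 in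
/-- Accelerated inexact proximal point method: a solver for the problem with an additional
proximal term in `x` yields a solver for the problem without it. -/
theorem ReducesWithin.accelerate [CompleteSpace E] [CompleteSpace F]
    (hXc : IsClosed X) (hX : Convex ℝ X) (hYc : IsClosed Y) (hY : Convex ℝ Y)
    (ha : 0 < a) (hb : 0 < b) (hβ : 0 < β) {N : ℕ} {R δ : ℝ} (hR : R = (a + β) / a)
    (h : ReducesWithin X Y (a + β) b (Lx + β) Ly Lxy N (1 / (256 * R ^ 2))) {k : ℕ}
    (hk : 64 * R ^ 3 * (1 - √(1 / R) / 4) ^ k ≤ δ) :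
    ReducesWithin X Y a b Lx Ly Lxy (k * N) δ := by
  obtain ⟨S, hS, hS'⟩ := h
  set τ := √(1 / R) with hτdef
  set m := a * β / (a + β) with hm
  have hR1 : 1 ≤ R := by rw [hR, le_div_iff₀ ha]; linarith
  have hτ : 0 < τ := Real.sqrt_pos.2 (by positivity)
  have hτ2 : τ ^ 2 = 1 / R := Real.sq_sqrt (by positivity)
  have hτ1 : τ ≤ 1 := Real.sqrt_le_one.2 ((div_le_one (by positivity)).2 hR1)
  have hm0 : 0 < m := by positivity
  have hMτ : β * τ ^ 2 = m := by rw [hτ2, hR, hm]; field_simp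
  have haR : a * R = a + β := by rw [hR]; field_simp
  have hmR : m * R = β := by rw [hR, hm]; field_simp
  let ext : E → E → E := fun x z => (1 + τ)⁻¹ • (x + τ • z)
  -- In the state `(x, z, t)` the accelerated iterates x and z range over all of `E`. The
  -- approximate proximal saddle point t is the warm start, supplies the gradient estimate β(y -
  -- t.1), and is the output.
  let next : E × E × (X × Y) → X × Y → E × E × (X × Y) := fun s t =>
    let y := ext s.1 s.2.1
    let zp := τ • y + (1 - τ) • s.2.1 - (τ / m) • β • (y - t.1)
    ((1 - τ) • s.1 + τ • zp, zp, t)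
  let step : (X × Y → E × F) → E × E × (X × Y) → E × E × (X × Y) := fun o s =>
    next s (S (proxOracle o β (ext s.1 s.2.1)) s.2.2)
  refine ⟨fun o z => ((step o)^[k] (z.1, z.1, z)).2.2, fun z => ?_, ?_⟩
  · have h1 : ∀ s, ComputableWithin N (fun o => step o s) := fun s =>
      ((hS s.2.2).translate (fun q (r : E × F) => (r.1 + β • ((q.1 : E) - ext s.1 s.2.1), r.2)) id).map
        (next s)
    exact (ComputableWithin.iterate h1 k ((z.1 : E), (z.1 : E), z)).map fun s => s.2.2
  · intro f o ho zs hzs z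
    have hprox : ∀ v, SaddleOracle X Y (a + β) b (Lx + β) Ly Lxy
        (fun x y => f x y + β / 2 * ‖(x : E) - v‖ ^ 2) (proxOracle o β v) :=
      fun v => ho.add_prox hβ.le v
    have hex : ∀ v, ∃ z, IsSaddle (proxOracle o β v) z := fun v =>
      (hprox v).exists_isSaddle (by positivity) hb ⟨_, zs.1.2⟩ hXc hX ⟨_, zs.2.2⟩ hYc hY
    choose sad hsad using hex
    set xs : E := (zs.1 : E) with hxs
    -- The proximal gradient vanishes at its own center, so `xs` is a fixed point of the proximal
    -- map and minimizes the envelope.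
    have hzs' : IsSaddle (proxOracle o β xs) zs := by
      refine ⟨fun x => ?_, hzs.2⟩
      have := hzs.1 x
      simpa [proxOracle, ← hxs] using this
    let g : E → ℝ := fun v => proxValue f β v (sad v)
    let gs : ℝ := proxValue f β xs zs
    let Φ : E × E × (X × Y) → ℝ := fun s => g s.1 - gs + m / 2 * ‖s.2.1 - xs‖ ^ 2
    -- Division by R puts the warm-start error on the scale of Φ, since the proximal saddle point at
    -- `y` lies within weighted squared distance 2RΦ of `zs`.
    let V : E × E × (X × Y) → ℝ := fun s => wdist (a + β) b s.2.2 zs / R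
    have hgs : ∀ v, m / 2 * ‖v - xs‖ ^ 2 ≤ g v - gs := fun v => by
      have := proxValue_strongly_convex ho ha hβ hb.le hzs' (hsad v)
      rw [← hxs, sub_self, smul_zero, inner_zero_left] at this
      change _ ≤ proxValue f β v (sad v) - proxValue f β xs zs
      linarith
    have hΦ0 : ∀ s, m / 2 * ‖s.1 - xs‖ ^ 2 + m / 2 * ‖s.2.1 - xs‖ ^ 2 ≤ Φ s := fun s =>
      add_le_add (hgs s.1) le_rfl
    have hΦnn : ∀ s, 0 ≤ Φ s := fun s => le_trans (by positivity) (hΦ0 s)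
    have hVnn : ∀ s, 0 ≤ V s := fun s =>
      div_nonneg (wdist_nonneg (by positivity) hb.le _ _) (by positivity)
    have hstep : ∀ s, Φ (step o s) + τ * V (step o s) / 32 ≤
        (1 - τ / 4) * (Φ s + τ * V s / 32) := by
      intro s
      set y := ext s.1 s.2.1 with hy
      set t := S (proxOracle o β y) s.2.2 with ht
      set w := τ • y + (1 - τ) • s.2.1 with hw
      set zp := w - (τ / m) • β • (y - (t.1 : E)) with hzp
      set e : E := β • ((sad y).1 - t.1) with he
      have hyE : (1 + τ) • y = s.1 + τ • s.2.1 := by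
        change (1 + τ) • ((1 + τ)⁻¹ • (s.1 + τ • s.2.1)) = _
        rw [smul_smul, mul_inv_cancel₀ (by positivity), one_smul]
      have hyd : ‖y - xs‖ ^ 2 ≤ 2 / m * Φ s := by
        have h3 := norm_extrapolation_sub_sq_le s.1 s.2.1 xs hτ.le
        have h4 := mul_le_mul_of_nonneg_left (hΦ0 s) (by positivity : 0 ≤ 2 / m)
        have e5 : 2 / m * (m / 2 * ‖s.1 - xs‖ ^ 2 + m / 2 * ‖s.2.1 - xs‖ ^ 2)
          = ‖s.1 - xs‖ ^ 2 + ‖s.2.1 - xs‖ ^ 2 := by field_simp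
        linarith
      have hWy : wdist (a + β) b (sad y) zs ≤ 2 * R * Φ s := by
        refine (wdist_prox_le ho ha.le hβ.le hb.le (hsad y) hzs').trans ?_
        refine (mul_le_mul_of_nonneg_left hyd hβ.le).trans_eq ?_
        rw [← hmR]
        field_simp
      have hWt : wdist (a + β) b t (sad y) ≤
          1 / (256 * R ^ 2) * (2 * (V s * R) + 2 * (2 * R * Φ s)) := by
        refine (hS' _ _ (hprox y) _ (hsad y) s.2.2).trans ?_
        refine mul_le_mul_of_nonneg_left ?_ (by positivity)
        refine (wdist_triangle (by positivity) hb.le _ zs _).trans ?_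
        rw [wdist_comm (a + β) b zs]
        have e1 : V s * R = wdist (a + β) b s.2.2 zs := div_mul_cancel₀ _ (by positivity)
        rw [e1]
        linarith
      -- The envelope is defined on all of `E`, so the step is unconstrained and optimality is an
      -- equality.
      have hopt : 0 ≤ ⟪τ • (β • (y - ((sad y).1 : E)) + e) + m • (zp - w), xs - zp⟫ := by
        have e1 : m • (zp - w) = -(τ • (β • (y - ((sad y).1 : E)) + e)) := by
          rw [hzp, he, sub_sub_cancel_left, smul_neg, smul_smul, mul_div_cancel₀ _ hm0.ne']
          module
        rw [e1, add_neg_cancel, inner_zero_left]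
      have hacc := accelerated_step (gxp := g ((1 - τ) • s.1 + τ • zp)) hτ hτ1 hm0.le hMτ hyE rfl hw
        (proxValue_smooth ho ha.le hβ.le hb.le (hsad y) (hsad _))
        (le_trans (le_add_of_nonneg_right (by positivity))
          (proxValue_strongly_convex ho ha hβ hb.le (hsad y) (hsad s.1)))
        (proxValue_strongly_convex ho ha hβ hb.le (hsad y) hzs') hopt
      have hΦ' : Φ (step o s) = g ((1 - τ) • s.1 + τ • zp) - gs + m / 2 * ‖zp - xs‖ ^ 2 := rfl
      have hV' : V (step o s) = wdist (a + β) b t zs / R := rfl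
      refine accelerated_potential (e := ‖e‖ ^ 2 / m) hτ hτ1 (hΦnn s) (hVnn s) ?_ ?_ ?_
      · rw [hΦ'] at *
        refine hacc.trans (add_le_add le_rfl (mul_le_mul_of_nonneg_left ?_ hτ.le))
        have g1 := inner_le_sq_div_add e xs zp hm0
        have g5 := hgs ((1 - τ) • s.1 + τ • zp)
        have g6 : 0 ≤ m / 2 * ‖(1 - τ) • s.1 + τ • zp - xs‖ ^ 2 := by positivity
        linarith
      · have g1 : (a + β) * ‖((sad y).1 : E) - t.1‖ ^ 2 ≤ wdist (a + β) b t (sad y) := by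
          unfold wdist
          rw [norm_sub_rev]
          exact le_add_of_nonneg_right (by positivity)
        -- Dividing by m costs one factor R and the scale of V another, whence the inner accuracy
        -- 1/(256 R²).
        have g2 : ‖e‖ ^ 2 / m ≤ R * ((a + β) * ‖((sad y).1 : E) - t.1‖ ^ 2) := by
          rw [he, norm_smul, Real.norm_of_nonneg hβ.le, mul_pow, div_le_iff₀ hm0, ← haR]
          have g3 : β ^ 2 ≤ R * (a * R) * m := by
            rw [← hmR]
            have : m ≤ a := by rw [hm, div_le_iff₀ (by positivity)]; nlinarith
            nlinarith [mul_nonneg (mul_nonneg hm0.le (sub_nonneg.2 this)) (sq_nonneg R)]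
          nlinarith [mul_le_mul_of_nonneg_right g3 (sq_nonneg ‖((sad y).1 : E) - t.1‖)]
        have g4 := mul_le_mul_of_nonneg_left (g1.trans hWt) (by positivity : 0 ≤ R)
        refine (g2.trans g4).trans_eq ?_
        field_simp
        ring
      · rw [hV', div_le_iff₀ (by positivity)]
        have g1 := wdist_triangle (by positivity : 0 ≤ a + β) hb.le t (sad y) zs
        have g2 : 1 / (256 * R ^ 2) * (2 * (V s * R) + 2 * (2 * R * Φ s))
            ≤ (2 * (V s * R) + 2 * (2 * R * Φ s)) / 256 := by
          rw [div_mul_eq_mul_div, one_mul]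
          have := hΦnn s
          have := hVnn s
          refine div_le_div_of_nonneg_left (by positivity) (by norm_num) ?_
          nlinarith
        have g3 : ((2 * V s + 4 * Φ s) / 128 + 4 * Φ s) * R
          = 2 * ((2 * (V s * R) + 2 * (2 * R * Φ s)) / 256) + 2 * (2 * R * Φ s) := by ring
        rw [g3]
        linarith
    have hiter : ∀ j, Φ ((step o)^[j] (z.1, z.1, z)) + τ * V ((step o)^[j] (z.1, z.1, z)) / 32 ≤
        (1 - τ / 4) ^ j * (Φ ((z.1 : E), (z.1 : E), z) + τ * V ((z.1 : E), (z.1 : E), z) / 32) := by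
      intro j
      induction j with
      | zero => simp
      | succ j ih =>
        rw [Function.iterate_succ_apply', pow_succ', mul_assoc]
        exact (hstep _).trans (mul_le_mul_of_nonneg_left ih (by linarith))
    have hw0 : 0 ≤ wdist a b z zs := wdist_nonneg ha.le hb.le _ _
    have haw : a * ‖(z.1 : E) - xs‖ ^ 2 ≤ wdist a b z zs :=
      le_add_of_nonneg_right (by positivity)
    have hbw : b * ‖(z.2 : F) - zs.2‖ ^ 2 ≤ wdist a b z zs :=
      le_add_of_nonneg_left (by positivity)
    have hinit : Φ ((z.1 : E), (z.1 : E), z) + τ * V ((z.1 : E), (z.1 : E), z) / 32 ≤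
        2 * R * wdist a b z zs := by
      have g1 := proxValue_smooth ho ha.le hβ.le hb.le hzs' (hsad z.1)
      rw [← hxs, sub_self, smul_zero, inner_zero_left] at g1
      have g2 : m ≤ β := by nlinarith
      have g3 : Φ ((z.1 : E), (z.1 : E), z) ≤ R * wdist a b z zs := by
        have k1 : Φ ((z.1 : E), (z.1 : E), z) ≤ β * ‖(z.1 : E) - xs‖ ^ 2 := by
          have := mul_le_mul_of_nonneg_right g2 (sq_nonneg ‖(z.1 : E) - xs‖)
          change proxValue f β z.1 (sad z.1) - proxValue f β xs zs
            + m / 2 * ‖(z.1 : E) - xs‖ ^ 2 ≤ _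
          linarith
        have k2 : β * ‖(z.1 : E) - xs‖ ^ 2 ≤ R * (a * ‖(z.1 : E) - xs‖ ^ 2) := by
          rw [← mul_assoc, mul_comm R a, haR]
          gcongr
          linarith
        exact k1.trans (k2.trans (mul_le_mul_of_nonneg_left haw (by positivity)))
      have g4 : V ((z.1 : E), (z.1 : E), z) ≤ wdist a b z zs := by
        change wdist (a + β) b z zs / R ≤ _
        rw [div_le_iff₀ (by positivity)]
        unfold wdist
        rw [← haR]
        have : 0 ≤ b * ‖(z.2 : F) - zs.2‖ ^ 2 := by positivity
        nlinarith
      have g5 : τ * V ((z.1 : E), (z.1 : E), z) ≤ wdist a b z zs := by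
        have := hVnn ((z.1 : E), (z.1 : E), z)
        nlinarith
      nlinarith
    set s := (step o)^[k] ((z.1 : E), (z.1 : E), z) with hs
    -- Undoing the weight τ/32 costs 32R², because Rτ ≥ 1. With the factor 2R of `hinit` this gives
    -- 64R³.
    have hfin : wdist a b s.2.2 zs ≤ 32 * R ^ 2 * (Φ s + τ * V s / 32) := by
      have g1 : wdist a b s.2.2 zs ≤ V s * R := by
        have e1 : V s * R = wdist (a + β) b s.2.2 zs := div_mul_cancel₀ _ (by positivity)
        rw [e1]
        unfold wdist
        gcongr
        linarith
      have g2 : 1 ≤ R * τ := by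
        have : R * τ ^ 2 = 1 := by rw [hτ2]; field_simp
        nlinarith
      have g3 : V s * R ≤ R ^ 2 * (τ * V s) := by
        have := mul_le_mul_of_nonneg_right g2 (mul_nonneg (by positivity : 0 ≤ R) (hVnn s))
        nlinarith
      have g4 : 0 ≤ R ^ 2 * Φ s := mul_nonneg (sq_nonneg _) (hΦnn s)
      linarith
    calc wdist a b s.2.2 zs ≤ 32 * R ^ 2 * ((1 - τ / 4) ^ k * (2 * R * wdist a b z zs)) := by
          refine hfin.trans (mul_le_mul_of_nonneg_left ((hiter k).trans ?_) (by positivity))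
          exact mul_le_mul_of_nonneg_left hinit (pow_nonneg (by linarith) k)
      _ = 64 * R ^ 3 * (1 - τ / 4) ^ k * wdist a b z zs := by ring
      _ ≤ δ * wdist a b z zs := mul_le_mul_of_nonneg_right hk hw0

end ProximalAcceleration

/-! ### From distance to duality gap. -/

section Gap

variable {E F : Type} [NormedAddCommGroup E] [InnerProductSpace ℝ E]
  [NormedAddCommGroup F] [InnerProductSpace ℝ F]

/-- The solution `xs` is fixed by the projected step along `gs`, and projections are nonexpansive.
-/
theorem norm_projected_step_sub_le {X : Set E} {x x' xs : X} {g gs : E} {μ : ℝ} (hμ : 0 < μ)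
    (hx' : ∀ w : X, ⟪(x : E) - μ⁻¹ • g - x', (w : E) - x'⟫ ≤ 0)
    (hxs : 0 ≤ ⟪gs, (x' : E) - xs⟫) :
    ‖(x : E) - x'‖ ≤ 2 * ‖(x : E) - xs‖ + μ⁻¹ * ‖g - gs‖ := by
  have h0 : ‖(x' : E) - xs‖ ≤ ‖(x : E) - xs‖ + μ⁻¹ * ‖g - gs‖ := by
    have h1 := hx' xs
    have h2 := mul_nonneg (inv_nonneg.2 hμ.le) hxs
    have h3 : ‖(x' : E) - xs‖ ^ 2 ≤ ⟪((x : E) - xs) - μ⁻¹ • (g - gs), (x' : E) - xs⟫ := by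
      rw [← real_inner_self_eq_norm_sq]
      rw [← neg_sub (x' : E) xs, inner_neg_right] at h1
      simp only [inner_sub_left, real_inner_smul_left] at *
      linarith
    have h4 := h3.trans (real_inner_le_norm _ _)
    have h5 : ‖((x : E) - xs) - μ⁻¹ • (g - gs)‖ ≤ ‖(x : E) - xs‖ + μ⁻¹ * ‖g - gs‖ := by
      refine (norm_sub_le _ _).trans_eq ?_
      rw [norm_smul, Real.norm_of_nonneg (inv_nonneg.2 hμ.le)]
    by_contra! h
    have h6 := h5.trans_lt h
    nlinarith [norm_nonneg (((x : E) - xs) - μ⁻¹ • (g - gs))]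
  have h1 := norm_sub_le_norm_sub_add_norm_sub (x : E) xs x'
  rw [norm_sub_rev (xs : E)] at h1
  linarith

/-- After projecting, `x'` solves the variational inequality up to the change of gradient and the
step length; the size of the gradient does not enter. -/
theorem inner_projected_step_le {X : Set E} {x x' u : X} {g g' : E} {μ : ℝ} (hμ : 0 < μ)
    (hx' : ∀ w : X, ⟪(x : E) - μ⁻¹ • g - x', (w : E) - x'⟫ ≤ 0) :
    ⟪g', (x' : E) - u⟫ ≤ (‖g' - g‖ + μ * ‖(x : E) - x'‖) * ‖(x' : E) - u‖ := by
  have h1 := mul_nonpos_of_nonneg_of_nonpos hμ.le (hx' u)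
  rw [← real_inner_smul_left, smul_sub, smul_sub, smul_smul, mul_inv_cancel₀ hμ.ne', one_smul,
    ← neg_sub (x' : E), inner_neg_right] at h1
  have h2 := real_inner_le_norm (g' - g) ((x' : E) - u)
  have h3 := mul_le_mul_of_nonneg_left (real_inner_le_norm ((x : E) - x') ((x' : E) - u)) hμ.le
  simp only [inner_sub_left, real_inner_smul_left] at *
  linarith

variable {X : Set E} {Y : Set F} {a b Lx Ly Lxy : ℝ} {f : X → Y → ℝ} {o : X × Y → E × F}

theorem SaddleOracle.norm_fst_sub_le (h : SaddleOracle X Y a b Lx Ly Lxy f o) (z z' : X × Y) :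
    ‖(o z).1 - (o z').1‖ ≤ Lx * ‖(z.1 : E) - z'.1‖ + Lxy * ‖(z.2 : F) - z'.2‖ :=
  (norm_sub_le_norm_sub_add_norm_sub _ (o (z'.1, z.2)).1 _).trans
    (add_le_add (h.lip_x z.1 z'.1 z.2) (h.lip_xy z'.1 z.2 z'.2))

/-- Since ε = 2 μx Dx², the hypotheses say Lx ≤ 2Λ μx and Lxy Dy ≤ (Λ/2) μx Dx, so all terms are
multiples of ρ Dx. -/
theorem SaddleOracle.norm_sub_projected_step_le {μx μy Dx Dy ε Λ ρ : ℝ}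
    (h : SaddleOracle X Y μx μy (Lx + μx) (Ly + μy) Lxy f o) (hμx : 0 < μx) (h0 : 0 < Dx)
    (hLx : 0 ≤ Lx) (hLxy : 0 ≤ Lxy) (hε : 2 * μx * Dx ^ 2 = ε) (hΛ : 2 ≤ Λ)
    (h1 : Lx * Dx ^ 2 ≤ Λ * ε) (h2 : 4 * (Lxy * (Dx * Dy)) ≤ Λ * ε) (hρ : 0 ≤ ρ)
    {z zs : X × Y} (hzs : IsSaddle o zs) (hx : ‖(z.1 : E) - zs.1‖ ≤ ρ * Dx)
    (hy : ‖(z.2 : F) - zs.2‖ ≤ ρ * Dy) {x' : X}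
    (hx' : ∀ w : X, ⟪(z.1 : E) - μx⁻¹ • (o z).1 - x', (w : E) - x'⟫ ≤ 0) :
    ‖(z.1 : E) - x'‖ ≤ 5 * Λ * ρ * Dx := by
  have g1 := norm_projected_step_sub_le hμx hx' (hzs.1 x')
  have g2 := h.norm_fst_sub_le z zs
  have g3 := mul_le_mul_of_nonneg_left hx (by positivity : 0 ≤ Lx + μx)
  have g4 := mul_le_mul_of_nonneg_left hy hLxy
  have g5 : μx⁻¹ * ‖(o z).1 - (o zs).1‖ ≤ (1 + 5 / 2 * Λ) * ρ * Dx := by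
    rw [inv_mul_le_iff₀ hμx]
    have e1 : (Lx + μx) * (ρ * Dx) + Lxy * (ρ * Dy) ≤ μx * ((1 + 5 / 2 * Λ) * ρ * Dx) := by
      refine le_of_mul_le_mul_right ?_ h0
      have k1 := mul_le_mul_of_nonneg_left h1 hρ
      have k2 := mul_le_mul_of_nonneg_left h2 hρ
      rw [← hε] at k1 k2
      nlinarith
    linarith
  have : 0 ≤ ρ * Dx := by positivity
  nlinarith

theorem SaddleOracle.inner_projected_step_le {μx μy Dx Dy ε Λ σ : ℝ}
    (h : SaddleOracle X Y μx μy (Lx + μx) (Ly + μy) Lxy f o) (hμx : 0 < μx)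
    (hLx : 0 ≤ Lx) (hLxy : 0 ≤ Lxy) (hε : 2 * μx * Dx ^ 2 = ε) (hΛ : 2 ≤ Λ)
    (h1 : Lx * Dx ^ 2 ≤ Λ * ε) (h2 : 4 * (Lxy * (Dx * Dy)) ≤ Λ * ε) (hσ : 0 ≤ σ)
    (hDx : 0 < Dx) {z z' : X × Y} (hx : ‖(z.1 : E) - z'.1‖ ≤ σ * Dx)
    (hy : ‖(z.2 : F) - z'.2‖ ≤ σ * Dy)
    (hx' : ∀ w : X, ⟪(z.1 : E) - μx⁻¹ • (o z).1 - z'.1, (w : E) - z'.1⟫ ≤ 0) {u : X}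
    (hu : ‖(z'.1 : E) - u‖ ≤ Dx) : ⟪(o z').1, (z'.1 : E) - u⟫ ≤ 2 * σ * Λ * ε := by
  have g1 := _root_.inner_projected_step_le (u := u) (g' := (o z').1) hμx hx'
  have g2 := h.norm_fst_sub_le z' z
  rw [norm_sub_rev (z'.1 : E), norm_sub_rev (z'.2 : F)] at g2
  have g3 := mul_le_mul_of_nonneg_left hx (by positivity : 0 ≤ Lx + μx)
  have g4 := mul_le_mul_of_nonneg_left hy hLxy
  have g5 := mul_le_mul_of_nonneg_left hx hμx.le
  have g6 : ‖(o z').1 - (o z).1‖ + μx * ‖(z.1 : E) - z'.1‖ ≤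
      (Lx + μx) * (σ * Dx) + Lxy * (σ * Dy) + μx * (σ * Dx) := by linarith
  have g7 : 0 ≤ ‖(o z').1 - (o z).1‖ + μx * ‖(z.1 : E) - z'.1‖ := by positivity
  refine g1.trans ((mul_le_mul g6 hu (norm_nonneg _) (g7.trans g6)).trans ?_)
  have k1 := mul_le_mul_of_nonneg_left h1 hσ
  have k2 := mul_le_mul_of_nonneg_left h2 hσ
  have k3 : 0 ≤ ε := by rw [← hε]; positivity
  have k4 := mul_le_mul_of_nonneg_right hΛ (mul_nonneg hσ k3)
  have k5 : σ * (2 * μx * Dx ^ 2) = σ * ε := by rw [hε]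
  nlinarith

/-- A projected gradient step from a point close to the saddle point has a small duality gap. -/
theorem SaddleOracle.gap_projected_step_le {μx μy Dx Dy ε Λ δ : ℝ}
    (h : SaddleOracle X Y μx μy (Lx + μx) (Ly + μy) Lxy f o) (hμx : 0 < μx) (hμy : 0 < μy)
    (hDx : 0 < Dx) (hDy : 0 < Dy) (hLx : 0 ≤ Lx) (hLy : 0 ≤ Ly) (hLxy : 0 ≤ Lxy)
    (hεx : 2 * μx * Dx ^ 2 = ε) (hεy : 2 * μy * Dy ^ 2 = ε) (hΛ : 2 ≤ Λ)
    (h1 : Lx * Dx ^ 2 ≤ Λ * ε) (h2 : Ly * Dy ^ 2 ≤ Λ * ε) (h3 : 4 * (Lxy * (Dx * Dy)) ≤ Λ * ε)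
    (hδ0 : 0 ≤ δ) (hδ : 3200 * Λ ^ 4 * δ ≤ 1)
    {z zs z' : X × Y} (hzs : IsSaddle o zs) (hz : wdist μx μy z zs ≤ δ * ε)
    (hx' : ∀ w : X, ⟪(z.1 : E) - μx⁻¹ • (o z).1 - z'.1, (w : E) - z'.1⟫ ≤ 0)
    (hy' : ∀ w : Y, ⟪(z.2 : F) - μy⁻¹ • (o z).2 - z'.2, (w : F) - z'.2⟫ ≤ 0)
    {u : X} {v : Y} (hu : ‖(z'.1 : E) - u‖ ≤ Dx) (hv : ‖(z'.2 : F) - v‖ ≤ Dy) :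
    f z'.1 v - f u z'.2 ≤ ε / 2 := by
  -- Relative to the diameters, the squared distances are at most δε/(μD²) = 2δ. Each player
  -- contributes at most 10Λ²ρε to the gap, and `hδ` makes this at most ε/4.
  set ρ := √(2 * δ) with hρdef
  have hρ : 0 ≤ ρ := Real.sqrt_nonneg _
  have hρ2 : ρ ^ 2 = 2 * δ := Real.sq_sqrt (by positivity)
  have hρ1 : 40 * Λ ^ 2 * ρ ≤ 1 := by
    refine abs_le_of_sq_le_sq' ?_ zero_le_one |>.2
    rw [mul_pow, hρ2]
    linarith
  have hx : ‖(z.1 : E) - zs.1‖ ≤ ρ * Dx := by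
    refine abs_le_of_sq_le_sq' (le_of_mul_le_mul_left ?_ hμx) (by positivity) |>.2
    have g1 : 0 ≤ μy * ‖(z.2 : F) - zs.2‖ ^ 2 := by positivity
    unfold wdist at hz
    rw [mul_pow, hρ2]
    rw [← hεx] at hz
    linarith
  have hy : ‖(z.2 : F) - zs.2‖ ≤ ρ * Dy := by
    refine abs_le_of_sq_le_sq' (le_of_mul_le_mul_left ?_ hμy) (by positivity) |>.2
    have g1 : 0 ≤ μx * ‖(z.1 : E) - zs.1‖ ^ 2 := by positivity
    unfold wdist at hz
    rw [mul_pow, hρ2]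
    rw [← hεy] at hz
    linarith
  have h3' : 4 * (Lxy * (Dy * Dx)) ≤ Λ * ε := by rwa [mul_comm Dy]
  have gx := h.norm_sub_projected_step_le hμx hDx hLx hLxy hεx hΛ h1 h3 hρ hzs hx hy hx'
  have gy := h.swap.norm_sub_projected_step_le hμy hDy hLy hLxy hεy hΛ h2 h3' hρ hzs.swap
    (z := z.swap) hy hx hy'
  have hσ : 0 ≤ 5 * Λ * ρ := by positivity
  have kx := h.inner_projected_step_le hμx hLx hLxy hεx hΛ h1 h3 hσ hDx gx gy hx' hu
  have ky := h.swap.inner_projected_step_le hμy hLy hLxy hεy hΛ h2 h3' hσ hDy (z := z.swap)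
    (z' := z'.swap) gy gx hy' hv
  have c1 := h.convex z'.1 u z'.2
  have c2 := h.concave z'.1 z'.2 v
  have c3 : 0 ≤ μx / 2 * ‖(u : E) - z'.1‖ ^ 2 := by positivity
  have c4 : 0 ≤ μy / 2 * ‖(v : F) - z'.2‖ ^ 2 := by positivity
  simp only [Prod.swap, Prod.mk.eta] at ky c1 c2
  rw [← neg_sub (z'.1 : E), inner_neg_right] at c1
  rw [← neg_sub (z'.2 : F), inner_neg_right] at c2
  rw [norm_neg] at c1 c2
  rw [← neg_sub (z'.1 : E), norm_neg] at c3
  rw [← neg_sub (z'.2 : F), norm_neg] at c4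
  have hε0 : 0 ≤ ε := by rw [← hεx]; positivity
  have k := mul_le_mul_of_nonneg_right hρ1 hε0
  have e : 2 * (5 * Λ * ρ) * Λ * ε = 40 * Λ ^ 2 * ρ * ε / 4 := by ring
  rw [e] at kx ky
  linarith

end Gap

/-! ### Choice of proximal weights and iteration counts. -/

section Parameters

/-- Proximal parameters for the two accelerations, relative to the strong convexity moduli. -/
theorem exists_prox_parameters {u v P Q T Γ : ℝ} (hu : 0 ≤ u) (hv : 0 ≤ v) (hP : 0 ≤ P)
    (hQ : 0 ≤ Q) (h1 : u * v ≤ T) (h2 : P * v ≤ T) (h3 : Q * u ≤ T) (hΓ : 1 ≤ Γ)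
    (huΓ : 2 * u ≤ Γ) (hvΓ : 2 * v ≤ Γ) (huvΓ : 4 * (u * v) ≤ Γ) :
    ∃ κx κy : ℝ, 1 ≤ κx ∧ 1 ≤ κy ∧ κx ≤ Γ ∧ κy ≤ Γ ∧ 4 * (u * v) ≤ κx * κy ∧
      κx * κy ≤ 1 + (P + Q) + 4 * T ∧ κy * P ≤ 1 + (P + Q) + 4 * T ∧
      κx * Q ≤ 1 + (P + Q) + 4 * T := by
  have hT : 0 ≤ T := (mul_nonneg hu hv).trans h1
  by_cases h : 4 * (u * v) ≤ 1
  · exact ⟨1, 1, le_rfl, le_rfl, hΓ, hΓ, by linarith, by linarith, by linarith, by linarith⟩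
  push Not at h
  by_cases hu1 : 2 * u ≤ 1
  -- The choice `2 * v` would be too large here, as v alone is not controlled by T; the coupling
  -- condition is met with equality instead.
  · exact ⟨1, 4 * (u * v), le_rfl, h.le, hΓ, huvΓ, by linarith, by linarith,
      by nlinarith [mul_nonneg hP hv], by linarith⟩
  by_cases hv1 : 2 * v ≤ 1
  · exact ⟨4 * (u * v), 1, h.le, le_rfl, huvΓ, hΓ, by linarith, by linarith, by linarith,
      by nlinarith [mul_nonneg hQ hu]⟩
  · exact ⟨2 * u, 2 * v, by linarith, by linarith, huΓ, hvΓ, by linarith, by linarith,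
      by linarith, by linarith⟩

/-- A geometric sequence falls below a given level after logarithmically many steps. -/
theorem exists_mul_pow_le {A q δ s : ℝ} (hA : 0 < A) (hq : 0 < q) (hq1 : q ≤ 1) (hδ : 0 < δ)
    (hs : A / δ ≤ Real.exp s) (hs0 : 0 ≤ s) :
    ∃ k : ℕ, A * (1 - q) ^ k ≤ δ ∧ (k : ℝ) ≤ s / q + 1 := by
  refine ⟨⌈s / q⌉₊, ?_, (Nat.ceil_lt_add_one (by positivity)).le⟩
  have h1 : (1 - q) ^ ⌈s / q⌉₊ ≤ Real.exp (-s) := by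
    have h2 : (1 - q) ^ ⌈s / q⌉₊ ≤ Real.exp (-q) ^ ⌈s / q⌉₊ :=
      pow_le_pow_left₀ (sub_nonneg.2 hq1) (by linarith [Real.add_one_le_exp (-q)]) _
    refine h2.trans ?_
    rw [← Real.exp_nat_mul]
    refine Real.exp_le_exp.2 ?_
    have h3 := Nat.le_ceil (s / q)
    rw [div_le_iff₀ hq] at h3
    linarith
  rw [div_le_iff₀ hδ] at hs
  have h4 := mul_le_mul_of_nonneg_right hs (Real.exp_pos (-s)).le
  have h5 : Real.exp s * δ * Real.exp (-s) = δ := by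
    rw [mul_right_comm, ← Real.exp_add, add_neg_cancel, Real.exp_zero, one_mul]
  rw [h5] at h4
  exact (mul_le_mul_of_nonneg_left h1 hA.le).trans h4

end Parameters

/-! ### Complexity of the nested loops. -/

section Complexity

/-- The exponent 8 is 2 for `M / a` plus 6 for 64 = 2⁶ ≤ Λ⁶; additive units are absorbed by log Λ ≥
1/2. -/
theorem exists_accelerated_steps {a M r Λ : ℝ} (ha : 0 < a) (haM : a ≤ M) (hr : 0 ≤ r)
    (hMr : M / a ≤ 2 + 2 * r) (hΛ : 2 ≤ Λ) (hMΛ : M / a ≤ Λ ^ 2) :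
    ∃ k : ℕ, M / a * (1 - √(a / M)) ^ k ≤ 1 / 64 ∧
      (k : ℝ) + 1 ≤ 20 * Real.log Λ * (1 + √r) := by
  have hM : 0 < M := ha.trans_le haM
  have hl : 1 / 2 ≤ Real.log Λ :=
    (by linarith [Real.log_two_gt_d9] : (1 / 2 : ℝ) ≤ Real.log 2).trans
      (Real.log_le_log (by norm_num) hΛ)
  have hq : 0 < √(a / M) := Real.sqrt_pos.2 (by positivity)
  obtain ⟨k, hk, hk'⟩ := exists_mul_pow_le (A := M / a) (δ := 1 / 64) (s := 8 * Real.log Λ)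
    (by positivity) hq (Real.sqrt_le_one.2 ((div_le_one hM).2 haM)) (by norm_num)
    (by
      rw [mul_comm, Real.exp_mul, Real.exp_log (by linarith)]
      have h1 : (2 : ℝ) ^ 6 ≤ Λ ^ 6 := pow_le_pow_left₀ (by norm_num) hΛ 6
      have h2 : Λ ^ (8 : ℝ) = Λ ^ 2 * Λ ^ 6 := by
        rw [← pow_add]; exact_mod_cast Real.rpow_natCast Λ 8
      rw [h2]
      have := mul_le_mul hMΛ h1 (by norm_num) (by positivity)
      linarith)
    (by linarith)
  refine ⟨k, hk, ?_⟩
  have h1 : 8 * Real.log Λ / √(a / M) = 8 * Real.log Λ * √(M / a) := by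
    rw [div_eq_mul_inv, ← Real.sqrt_inv, inv_div]
  have h2 : √(M / a) ≤ 2 * (1 + √r) := by
    rw [Real.sqrt_le_left (by positivity)]
    have := Real.sq_sqrt hr
    nlinarith [Real.sqrt_nonneg r]
  have h3 := mul_le_mul_of_nonneg_left h2 (by linarith : 0 ≤ 8 * Real.log Λ)
  rw [h1] at hk'
  have h4 : 0 ≤ Real.log Λ * √r := mul_nonneg (by linarith) (Real.sqrt_nonneg r)
  linarith

/-- The two uses need exponents 29 and 31, so 35 leaves room for both. -/
theorem exists_outer_steps {κ δ Λ : ℝ} (hκ : 1 ≤ κ) (hδ : 0 < δ) (hΛ : 2 ≤ Λ)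
    (h : 64 * (1 + κ) ^ 3 / δ ≤ Λ ^ 35) :
    ∃ k : ℕ, 64 * (1 + κ) ^ 3 * (1 - √(1 / (1 + κ)) / 4) ^ k ≤ δ ∧
      (k : ℝ) ≤ 282 * Real.log Λ * √κ := by
  have hl : 1 / 2 ≤ Real.log Λ :=
    (by linarith [Real.log_two_gt_d9] : (1 / 2 : ℝ) ≤ Real.log 2).trans
      (Real.log_le_log (by norm_num) hΛ)
  have hq : 0 < √(1 / (1 + κ)) := Real.sqrt_pos.2 (by positivity)
  have hq1 : √(1 / (1 + κ)) ≤ 1 :=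
    Real.sqrt_le_one.2 ((div_le_one (by positivity)).2 (by linarith))
  obtain ⟨k, hk, hk'⟩ := exists_mul_pow_le (A := 64 * (1 + κ) ^ 3) (δ := δ)
    (s := 35 * Real.log Λ) (q := √(1 / (1 + κ)) / 4) (by positivity) (by positivity)
    (by linarith) hδ
    (by
      rw [mul_comm 35, Real.exp_mul, Real.exp_log (by linarith)]
      exact h.trans_eq (by exact_mod_cast (Real.rpow_natCast Λ 35).symm))
    (by linarith)
  refine ⟨k, hk, hk'.trans ?_⟩
  have h1 : 35 * Real.log Λ / (√(1 / (1 + κ)) / 4) = 140 * Real.log Λ * √(1 + κ) := by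
    rw [one_div, Real.sqrt_inv]
    field_simp
    norm_num
  have h2 : √(1 + κ) ≤ 2 * √κ := by
    rw [Real.sqrt_le_left (by positivity), mul_pow, Real.sq_sqrt (by linarith)]
    linarith
  have h3 := mul_le_mul_of_nonneg_left h2 (by linarith : 0 ≤ 140 * Real.log Λ)
  have h4 : 1 ≤ √κ := Real.one_le_sqrt.2 hκ
  rw [h1]
  nlinarith

/-- Multiplying √(κx κy) into the sum turns P/κx into κy P and Q/κy into κx Q, which the choice of
weights bounds. -/
theorem nested_iterations_le {l κx κy P Q T : ℝ} (hκx : 0 < κx) (hκy : 0 < κy)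
    (hP0 : 0 ≤ P) (hQ0 : 0 ≤ Q) (hT0 : 0 ≤ T) (b1 : κx * κy ≤ 1 + (P + Q) + 4 * T)
    (b2 : κy * P ≤ 1 + (P + Q) + 4 * T) (b3 : κx * Q ≤ 1 + (P + Q) + 4 * T) :
    282 * l * √κx * (282 * l * √κy * (37 * l * (20 * l * (2 + √(P / κx) + √(Q / κy))))) ≤
      500000000 * (1 + √(P + Q) + √T) * l ^ 4 := by
  have e1 : √κx * √κy * √(P / κx) = √(κy * P) := by
    rw [← Real.sqrt_mul (by positivity), ← Real.sqrt_mul (by positivity)]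
    congr 1
    field_simp
  have e2 : √κx * √κy * √(Q / κy) = √(κx * Q) := by
    rw [← Real.sqrt_mul (by positivity), ← Real.sqrt_mul (by positivity)]
    congr 1
    field_simp
  have e3 : √κx * √κy = √(κx * κy) := (Real.sqrt_mul (by positivity) _).symm
  have e4 : 282 * l * √κx * (282 * l * √κy * (37 * l * (20 * l * (2 + √(P / κx) + √(Q / κy)))))
      = 58847760 * l ^ 4 * (2 * (√κx * √κy) + √κx * √κy * √(P / κx) + √κx * √κy * √(Q / κy)) := by
    ring
  rw [e4, e1, e2, e3]
  set B := 1 + √(P + Q) + √T with hB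
  have hB0 : 0 ≤ B := by positivity
  have hbound : √(1 + (P + Q) + 4 * T) ≤ 2 * B := by
    rw [Real.sqrt_le_left (by positivity)]
    have g1 := Real.sq_sqrt (add_nonneg hP0 hQ0)
    have g2 := Real.sq_sqrt hT0
    have g3 := Real.sqrt_nonneg (P + Q)
    have g4 := Real.sqrt_nonneg T
    rw [hB]
    nlinarith [mul_nonneg g3 g4]
  have c1 := (Real.sqrt_le_sqrt b1).trans hbound
  have c2 := (Real.sqrt_le_sqrt b2).trans hbound
  have c3 := (Real.sqrt_le_sqrt b3).trans hbound
  have c4 : 2 * √(κx * κy) + √(κy * P) + √(κx * Q) ≤ 8 * B := by linarith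
  have c5 := mul_le_mul_of_nonneg_left c4 (by positivity : 0 ≤ 58847760 * l ^ 4)
  have c6 : 0 ≤ l ^ 4 * B := by positivity
  linarith

variable {E F : Type} [NormedAddCommGroup E] [InnerProductSpace ℝ E] [CompleteSpace E]
  [NormedAddCommGroup F] [InnerProductSpace ℝ F] [CompleteSpace F]

set_option maxHeartbeats 400000 in
/-- Two nested accelerated proximal point loops around alternating best responses. -/
theorem exists_reducesWithin {X : Set E} {Y : Set F}
    (hXc : IsClosed X) (hX : Convex ℝ X) (hYc : IsClosed Y) (hY : Convex ℝ Y)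
    {μx μy Lx Ly Lxy L Λ : ℝ} (hμx : 0 < μx) (hμy : 0 < μy) (hLx : 0 ≤ Lx) (hLy : 0 ≤ Ly)
    (hLxy : 0 ≤ Lxy) (hLxL : Lx ≤ L) (hLyL : Ly ≤ L) (hLxyL : Lxy ≤ L) (hΛ : 2 ≤ Λ)
    (hP : Lx / μx ≤ 2 * (Λ - 2)) (hQ : Ly / μy ≤ 2 * (Λ - 2))
    (hu : Lxy / μx ≤ 2 * (Λ - 2)) (hv : Lxy / μy ≤ 2 * (Λ - 2))
    (huv : 4 * (Lxy / μx * (Lxy / μy)) ≤ Λ ^ 2) :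
    ∃ N : ℕ, ReducesWithin X Y μx μy (Lx + μx) (Ly + μy) Lxy N (1 / Λ ^ 16) ∧
      (N : ℝ) ≤ 500000000 * (1 + √(Lx / μx + Ly / μy) + √(L * Lxy / (μx * μy)))
        * Real.log Λ ^ 4 := by
  set P := Lx / μx with hPdef
  set Q := Ly / μy with hQdef
  set T := L * Lxy / (μx * μy) with hT
  have hP0 : 0 ≤ P := by positivity
  have hQ0 : 0 ≤ Q := by positivity
  have hT0 : 0 ≤ T := div_nonneg (mul_nonneg (hLx.trans hLxL) hLxy) (by positivity)
  have hΛ2 : 4 * (Λ - 2) ≤ Λ ^ 2 := by nlinarith [sq_nonneg (Λ - 2)]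
  have hprod : ∀ {s}, s ≤ L → s / μx * (Lxy / μy) ≤ T := fun {s} hs => by
    rw [div_mul_div_comm, hT]
    gcongr
  have hl : 1 / 2 ≤ Real.log Λ :=
    (by linarith [Real.log_two_gt_d9] : (1 / 2 : ℝ) ≤ Real.log 2).trans
      (Real.log_le_log (by norm_num) hΛ)
  obtain ⟨κx, κy, hκx, hκy, hκxΛ, hκyΛ, hκ, b1, b2, b3⟩ :=
    exists_prox_parameters (u := Lxy / μx) (v := Lxy / μy) (P := P) (Q := Q) (T := T)
      (Γ := Λ ^ 2) (by positivity) (by positivity) hP0 hQ0 (hprod hLxyL) (hprod hLxL)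
      (by rw [hQdef, div_mul_div_comm, hT, mul_comm μy]; gcongr)
      (by nlinarith) (by linarith) (by linarith) huv
  have hRΛ : ∀ {κ}, κ ≤ Λ ^ 2 → 1 + κ ≤ Λ ^ 3 := fun {κ} h => by nlinarith [sq_nonneg (Λ - 1)]
  have htwo : ∀ j : ℕ, (2 : ℝ) ^ j ≤ Λ ^ j := fun j => pow_le_pow_left₀ (by norm_num) hΛ j
  have inner : ∀ {l μ κ p : ℝ}, 0 ≤ l → 0 < μ → 1 ≤ κ → p = l / μ → p ≤ 2 * (Λ - 2) →
      ∃ k : ℕ, 2 * (l + μ + κ * μ) / (μ + κ * μ) *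
        (1 - √((μ + κ * μ) / (2 * (l + μ + κ * μ)))) ^ k ≤ 1 / 64 ∧
        (k : ℝ) + 1 ≤ 20 * Real.log Λ * (1 + √(p / κ)) := by
    intro l μ κ p hl0 hμ hκ hp hpΛ
    have hlp : l = p * μ := by rw [hp]; field_simp
    have hp0 : 0 ≤ p := by rw [hp]; positivity
    have e : 2 * (l + μ + κ * μ) / (μ + κ * μ) = 2 + 2 * (p / (1 + κ)) := by
      rw [hlp]; field_simp; ring
    have g1 : p / (1 + κ) ≤ p / κ := by gcongr; linarith
    have g2 : p / (1 + κ) ≤ p / 2 := by gcongr; linarith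
    refine exists_accelerated_steps (by positivity) ?_ (by positivity) (by rw [e]; linarith) hΛ
      (by rw [e]; nlinarith)
    have : 0 ≤ κ * μ := by positivity
    linarith
  obtain ⟨k1, hk1, hk1'⟩ := inner hLx hμx hκx hPdef hP
  obtain ⟨k2, hk2, hk2'⟩ := inner hLy hμy hκy hQdef hQ
  -- Here 7/16 is 1 - 9/16, and 15 = 9 + 6 accounts for 2 · 256 = 2⁹ and (1 + κy)² ≤ (Λ³)².
  obtain ⟨k0, hk0, hk0'⟩ := exists_mul_pow_le (A := 2) (q := 7 / 16)
    (δ := 1 / (256 * (1 + κy) ^ 2)) (s := 15 * Real.log Λ) (by norm_num) (by norm_num)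
    (by norm_num) (by positivity)
    (by
      rw [mul_comm 15, Real.exp_mul, Real.exp_log (by linarith)]
      have h1 : Λ ^ (15 : ℝ) = Λ ^ 9 * (Λ ^ 3) ^ 2 := by
        rw [← pow_mul, ← pow_add]; exact_mod_cast Real.rpow_natCast Λ 15
      have h2 : 2 / (1 / (256 * (1 + κy) ^ 2)) = 2 ^ 9 * (1 + κy) ^ 2 := by
        field_simp; norm_num
      rw [h1, h2]
      exact mul_le_mul (htwo 9) (pow_le_pow_left₀ (by linarith) (hRΛ hκyΛ) 2) (by positivity)
        (by positivity))
    (by linarith)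
  obtain ⟨ky, hky, hky'⟩ := exists_outer_steps (κ := κy) (δ := 1 / (256 * (1 + κx) ^ 2))
    hκy (by positivity) hΛ
    (by
      have h2 : 64 * (1 + κy) ^ 3 / (1 / (256 * (1 + κx) ^ 2))
          = 2 ^ 14 * ((1 + κy) ^ 3 * (1 + κx) ^ 2) := by field_simp; norm_num
      have h3 : (1 + κy) ^ 3 * (1 + κx) ^ 2 ≤ (Λ ^ 3) ^ 3 * (Λ ^ 3) ^ 2 :=
        mul_le_mul (pow_le_pow_left₀ (by linarith) (hRΛ hκyΛ) 3)
          (pow_le_pow_left₀ (by linarith) (hRΛ hκxΛ) 2) (by positivity) (by positivity)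
      rw [h2]
      refine (mul_le_mul (htwo 14) h3 (by positivity) (by positivity)).trans ?_
      rw [← pow_mul, ← pow_mul, ← pow_add, ← pow_add]
      exact pow_le_pow_right₀ (by linarith) (by norm_num))
  obtain ⟨kx, hkx, hkx'⟩ := exists_outer_steps (κ := κx) (δ := 1 / Λ ^ 16)
    hκx (by positivity) hΛ
    (by
      have h2 : 64 * (1 + κx) ^ 3 / (1 / Λ ^ 16) = 2 ^ 6 * ((1 + κx) ^ 3 * Λ ^ 16) := by
        field_simp; norm_num
      have h3 : (1 + κx) ^ 3 * Λ ^ 16 ≤ (Λ ^ 3) ^ 3 * Λ ^ 16 :=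
        mul_le_mul_of_nonneg_right (pow_le_pow_left₀ (by linarith) (hRΛ hκxΛ) 3) (by positivity)
      rw [h2]
      refine (mul_le_mul (htwo 6) h3 (by positivity) (by positivity)).trans ?_
      rw [← pow_mul, ← pow_add, ← pow_add]
      exact pow_le_pow_right₀ (by linarith) (by norm_num))
  have hκμx : 0 < κx * μx := by positivity
  have hκμy : 0 < κy * μy := by positivity
  have hRx : 1 + κx = (μx + κx * μx) / μx := by field_simp
  have hRy : 1 + κy = (μy + κy * μy) / μy := by field_simp
  have hweak : 4 * Lxy ^ 2 ≤ (μx + κx * μx) * (μy + κy * μy) := by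
    have g1 := mul_le_mul_of_nonneg_right hκ (by positivity : 0 ≤ μx * μy)
    have g2 : 4 * (Lxy / μx * (Lxy / μy)) * (μx * μy) = 4 * Lxy ^ 2 := by field_simp
    rw [g2] at g1
    refine g1.trans ?_
    have e : κx * κy * (μx * μy) = κx * μx * (κy * μy) := by ring
    rw [e]
    exact mul_le_mul (by linarith) (by linarith) hκμy.le (by positivity)
  rw [show (1 - 7 / 16 : ℝ) = 9 / 16 by norm_num] at hk0
  have s0 := ReducesWithin.of_weak_coupling hXc hX hYc hY (by positivity) (by positivity)
    (by linarith) (by linarith) hweak hk1 hk2 hk0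
  -- The proximal term in y is removed first, with the players exchanged, then the one in x. Each
  -- loop delivers the accuracy that the next one requires.
  have s1 := (ReducesWithin.accelerate hYc hY hXc hX hμy (by positivity) hκμy hRy s0.swap hky).swap
  have s2 := ReducesWithin.accelerate hXc hX hYc hY hμx hμy hκμx hRx s1 hkx
  refine ⟨_, s2, ?_⟩
  push_cast
  set l := Real.log Λ with hldef
  have hl0 : 0 ≤ l := by linarith
  have hk0'' : (k0 : ℝ) ≤ 37 * l := by linarith
  have hsum : (k1 : ℝ) + 1 + (k2 + 1) ≤ 20 * l * (2 + √(P / κx) + √(Q / κy)) := by linarith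
  have hN : (kx : ℝ) * (ky * (k0 * (k1 + 1 + (k2 + 1)))) ≤
      282 * l * √κx * (282 * l * √κy * (37 * l * (20 * l * (2 + √(P / κx) + √(Q / κy))))) := by
    gcongr
  refine hN.trans ?_
  exact nested_iterations_le (by linarith) (by linarith) hP0 hQ0 hT0 b1 b2 b3

end Complexity

/-! ### From smooth convex-concave functions to saddle oracles. -/

section FirstOrder

/-- `X` may have empty interior, but the gradient is ambient: slopes towards `x'` tend to the
directional derivative, and convexity bounds each by `φ x' - φ x`. -/
theorem ConvexOn.add_inner_le_of_hasGradientAt {E : Type} [NormedAddCommGroup E]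
    [InnerProductSpace ℝ E] [CompleteSpace E] {X : Set E} {φ : E → ℝ} {g x x' : E}
    (h : ConvexOn ℝ X φ) (hg : HasGradientAt φ g x) (hx : x ∈ X) (hx' : x' ∈ X) :
    φ x + ⟪g, x' - x⟫ ≤ φ x' := by
  have h1 : HasLineDerivAt ℝ φ ⟪g, x' - x⟫ x (x' - x) := by
    simpa using hg.hasFDerivAt.hasLineDerivAt (x' - x)
  have h2 := h1.tendsto_slope_zero_right
  have h3 : ∀ᶠ t : ℝ in nhdsWithin 0 (Set.Ioi 0),
      t⁻¹ • (φ (x + t • (x' - x)) - φ x) ≤ φ x' - φ x := by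
    filter_upwards [Ioc_mem_nhdsGT (zero_lt_one' ℝ)] with t ht
    have h4 := h.2 hx hx' (sub_nonneg.2 ht.2) ht.1.le (sub_add_cancel 1 t)
    have e : (1 - t) • x + t • x' = x + t • (x' - x) := by module
    rw [e] at h4
    rw [smul_eq_mul, inv_mul_le_iff₀ ht.1]
    simp only [smul_eq_mul] at h4
    linarith
  have h4 := le_of_tendsto h2 h3
  linarith

variable {n m : ℕ} {X : Set (Eucl n)} {Y : Set (Eucl m)} {Lx Lxy Ly : ℝ}
  {f : Eucl n → Eucl m → ℝ}

theorem IsSmoothOn.hasGradientAt_fst (hs : IsSmoothOn X Y Lx Lxy Ly f) {x : Eucl n} {y : Eucl m}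
    (hx : x ∈ X) (hy : y ∈ Y) : HasGradientAt (fun u => f u y) (gradX f x y) x := by
  have h1 : DifferentiableAt ℝ (fun u : Eucl n => (u, y)) x := by fun_prop
  exact (DifferentiableAt.comp x (hs.differentiableAt x hx y hy) h1).hasGradientAt

theorem IsSmoothOn.hasGradientAt_snd (hs : IsSmoothOn X Y Lx Lxy Ly f) {x : Eucl n} {y : Eucl m}
    (hx : x ∈ X) (hy : y ∈ Y) : HasGradientAt (fun v => f x v) (gradY f x y) y := by
  have h1 : DifferentiableAt ℝ (fun v : Eucl m => (x, v)) y := by fun_prop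
  exact (DifferentiableAt.comp y (hs.differentiableAt x hx y hy) h1).hasGradientAt

/-- The gradient oracle of a smooth convex-concave function as a saddle operator. -/
theorem IsSmoothOn.saddleOracle (hs : IsSmoothOn X Y Lx Lxy Ly f) (hc : IsConvexConcaveOn X Y f) :
    SaddleOracle X Y 0 0 Lx Ly Lxy (fun x y => f x y)
      (fun q => ((gradOracle X Y f q).1, -(gradOracle X Y f q).2)) where
  convex x x' y := by
    have := (hc.convex y y.2).add_inner_le_of_hasGradientAt
      (hs.hasGradientAt_fst x.2 y.2) x.2 x'.2
    simpa [gradOracle] using this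
  concave x y y' := by
    have h1 : HasGradientAt (-fun v => f x v) (-gradY f x y) (y : Eucl m) := by
      have := (hs.hasGradientAt_snd x.2 y.2).hasFDerivAt.neg
      rw [hasGradientAt_iff_hasFDerivAt, map_neg]
      exact this
    have h2 := (hc.concave x x.2).neg.add_inner_le_of_hasGradientAt h1 y.2 y'.2
    simp only [Pi.neg_apply] at h2
    simp only [gradOracle]
    linarith
  lip_x x x' y := hs.lip_x y y.2 x x.2 x' x'.2
  lip_y x y y' := by
    rw [neg_sub_neg, norm_sub_rev]
    exact hs.lip_y x x.2 y y.2 y' y'.2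
  lip_xy x y y' := hs.lip_xy x x.2 y y.2 y' y'.2
  lip_yx x x' y := by
    rw [neg_sub_neg, norm_sub_rev]
    exact hs.lip_yx y y.2 x x.2 x' x'.2

/-- The saddle operator of the regularized function, computed from the gradient oracle. -/
theorem IsSmoothOn.saddleOracle_regularized (hs : IsSmoothOn X Y Lx Lxy Ly f)
    (hc : IsConvexConcaveOn X Y f) {ε Dx Dy μx μy : ℝ} (hε : 0 ≤ ε)
    (hμx : μx = ε / (2 * Dx ^ 2)) (hμy : μy = ε / (2 * Dy ^ 2)) (x₀ : Eucl n) (y₀ : Eucl m) :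
    SaddleOracle X Y μx μy (Lx + μx) (Ly + μy) Lxy
      (fun x y => regularized f ε Dx Dy x₀ y₀ x y)
      (fun q => ((gradOracle X Y f q).1 + μx • ((q.1 : Eucl n) - x₀),
        -(gradOracle X Y f q).2 + μy • ((q.2 : Eucl m) - y₀))) := by
  have hμx0 : 0 ≤ μx := by rw [hμx]; positivity
  have hμy0 : 0 ≤ μy := by rw [hμy]; positivity
  -- The regularizers are proximal terms, since ε/(4D²) = μ/2; the one for y is added with the
  -- players exchanged.
  have h := (((hs.saddleOracle hc).add_prox hμx0 x₀).swap.add_prox hμy0 y₀).swap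
  rw [zero_add, zero_add] at h
  convert! h using 3 with x y
  unfold regularized
  rw [hμx, hμy]
  ring

/-- The four regularization terms lie in [0, ε/4], and only two enter with the unfavourable sign. -/
theorem regularized_saddle {ε Dx Dy : ℝ} (hε : 0 ≤ ε) (hDx : 0 < Dx) (hDy : 0 < Dy)
    {x₀ x u : Eucl n} {y₀ y v : Eucl m} (hx : ‖x - x₀‖ ≤ Dx) (hu : ‖u - x₀‖ ≤ Dx)
    (hy : ‖y - y₀‖ ≤ Dy) (hv : ‖v - y₀‖ ≤ Dy) :
    f x v - f u y ≤ regularized f ε Dx Dy x₀ y₀ x v - regularized f ε Dx Dy x₀ y₀ u y + ε / 2 := by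
  have aux : ∀ {r D : ℝ}, 0 ≤ r → 0 < D → r ≤ D → 0 ≤ ε * r ^ 2 / (4 * D ^ 2) ∧
      ε * r ^ 2 / (4 * D ^ 2) ≤ ε / 4 := by
    intro r D hr hD hrD
    refine ⟨by positivity, ?_⟩
    rw [div_le_div_iff₀ (by positivity) (by norm_num)]
    have := mul_le_mul_of_nonneg_left (pow_le_pow_left₀ hr hrD 2) hε
    linarith
  have h1 := aux (norm_nonneg _) hDx hx
  have h2 := aux (norm_nonneg _) hDx hu
  have h3 := aux (norm_nonneg _) hDy hy
  have h4 := aux (norm_nonneg _) hDy hv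
  unfold regularized
  linarith [h1.1, h1.2, h2.1, h2.2, h3.1, h3.2, h4.1, h4.2]

theorem isEpsSaddle_of_forall_le {h : Eucl n → Eucl m → ℝ} {ε : ℝ} {x' : Eucl n} {y' : Eucl m}
    (hX : IsCompact X) (hY : IsCompact Y) (hx' : x' ∈ X) (hy' : y' ∈ Y)
    (hcx : ContinuousOn (fun x => h x y') X) (hcy : ContinuousOn (fun y => h x' y) Y)
    (hle : ∀ x ∈ X, ∀ y ∈ Y, h x' y - h x y' ≤ ε) : IsEpsSaddle X Y h ε x' y' := by
  obtain ⟨v, hv, hv'⟩ := hY.exists_isMaxOn ⟨_, hy'⟩ hcy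
  obtain ⟨u, hu, hu'⟩ := hX.exists_isMinOn ⟨_, hx'⟩ hcx
  refine ⟨hx', hy', h x' v, h u y', ⟨⟨v, hv, rfl⟩, ?_⟩, ⟨⟨u, hu, rfl⟩, ?_⟩, hle u hu v hv⟩
  · rintro _ ⟨y, hy, rfl⟩
    exact hv' hy
  · rintro _ ⟨x, hx, rfl⟩
    exact hu' hx

theorem IsSmoothOn.isEpsSaddle (hs : IsSmoothOn X Y Lx Lxy Ly f) (hX : IsCompact X)
    (hY : IsCompact Y) {ε Dx Dy : ℝ} (hε : 0 ≤ ε) (hDx : 0 < Dx) (hDy : 0 < Dy)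
    {x₀ x' : Eucl n} {y₀ y' : Eucl m} (hx' : x' ∈ X) (hy' : y' ∈ Y)
    (hX₀ : ∀ x ∈ X, ‖x - x₀‖ ≤ Dx) (hY₀ : ∀ y ∈ Y, ‖y - y₀‖ ≤ Dy)
    (hle : ∀ x ∈ X, ∀ y ∈ Y, regularized f ε Dx Dy x₀ y₀ x' y
      - regularized f ε Dx Dy x₀ y₀ x y' ≤ ε / 2) :
    IsEpsSaddle X Y (regularized f ε Dx Dy x₀ y₀) (ε / 2) x' y' ∧ IsEpsSaddle X Y f ε x' y' := by
  have hcx : ContinuousOn (fun x => f x y') X := fun x hx =>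
    (hs.hasGradientAt_fst hx hy').differentiableAt.continuousAt.continuousWithinAt
  have hcy : ContinuousOn (fun y => f x' y) Y := fun y hy =>
    (hs.hasGradientAt_snd hx' hy).differentiableAt.continuousAt.continuousWithinAt
  refine ⟨isEpsSaddle_of_forall_le hX hY hx' hy' ?_ ?_ hle,
    isEpsSaddle_of_forall_le hX hY hx' hy' hcx hcy fun x hx y hy => ?_⟩
  · unfold regularized
    fun_prop
  · unfold regularized
    fun_prop
  · have h1 := hle x hx y hy
    have h2 := regularized_saddle (f := f) hε hDx hDy (hX₀ x' hx') (hX₀ x hx) (hY₀ y' hy')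
      (hY₀ y hy)
    linarith

end FirstOrder

/-! ### Assembly of the method and its query count. -/

theorem oracle_calls_le {N Lx Ly L Lxy Dx Dy ε Λ μx μy : ℝ} (hDx : 0 < Dx) (hDy : 0 < Dy)
    (hLx : 0 ≤ Lx) (hLy : 0 ≤ Ly) (hε : 0 < ε) (hΛ : 2 ≤ Λ)
    (hμx : μx = ε / (2 * Dx ^ 2)) (hμy : μy = ε / (2 * Dy ^ 2))
    (hN : N ≤ 500000000 * (1 + √(Lx / μx + Ly / μy) + √(L * Lxy / (μx * μy)))
      * Real.log Λ ^ 4) :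
    N + 1 ≤ 2000000000 * (1 + √((Lx * Dx ^ 2 + Ly * Dy ^ 2) / ε)
      + Dx * Dy * √(L * Lxy) / ε) * Real.log Λ ^ 4 := by
  have hl : 1 / 2 ≤ Real.log Λ :=
    (by linarith [Real.log_two_gt_d9] : (1 / 2 : ℝ) ≤ Real.log 2).trans
      (Real.log_le_log (by norm_num) hΛ)
  have hl4 : (1 / 2 : ℝ) ^ 4 ≤ Real.log Λ ^ 4 := pow_le_pow_left₀ (by norm_num) hl 4
  have e1 : √(Lx / μx + Ly / μy) ≤ 2 * √((Lx * Dx ^ 2 + Ly * Dy ^ 2) / ε) := by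
    have e : Lx / μx + Ly / μy = 2 * ((Lx * Dx ^ 2 + Ly * Dy ^ 2) / ε) := by
      rw [hμx, hμy]; field_simp
    have h0 : 0 ≤ (Lx * Dx ^ 2 + Ly * Dy ^ 2) / ε := by positivity
    rw [e, Real.sqrt_le_left (by positivity), mul_pow, Real.sq_sqrt h0]
    linarith
  have e2 : √(L * Lxy / (μx * μy)) = 2 * (Dx * Dy * √(L * Lxy) / ε) := by
    have e : L * Lxy / (μx * μy) = (2 * (Dx * Dy) / ε) ^ 2 * (L * Lxy) := by
      rw [hμx, hμy]; field_simp
    rw [e, Real.sqrt_mul (sq_nonneg _), Real.sqrt_sq (by positivity)]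
    ring
  rw [e2] at hN
  have h3 : 0 ≤ √((Lx * Dx ^ 2 + Ly * Dy ^ 2) / ε) := Real.sqrt_nonneg _
  have h4 : 0 ≤ Dx * Dy * √(L * Lxy) / ε := by positivity
  have h5 : 1 + √(Lx / μx + Ly / μy) + 2 * (Dx * Dy * √(L * Lxy) / ε) ≤
      2 * (1 + √((Lx * Dx ^ 2 + Ly * Dy ^ 2) / ε) + Dx * Dy * √(L * Lxy) / ε) := by linarith
  have h6 := mul_le_mul_of_nonneg_right h5 (by positivity : 0 ≤ Real.log Λ ^ 4)
  have h7 : Real.log Λ ^ 4 ≤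
      (1 + √((Lx * Dx ^ 2 + Ly * Dy ^ 2) / ε) + Dx * Dy * √(L * Lxy) / ε) * Real.log Λ ^ 4 :=
    le_mul_of_one_le_left (by positivity) (by linarith)
  linarith

theorem corollary2 :
    ∃ C : ℝ, 0 < C ∧
      ∀ (n m : ℕ) (X : Set (Eucl n)) (Y : Set (Eucl m)),
      IsCompact X → Convex ℝ X → IsCompact Y → Convex ℝ Y →
      ∀ x₀ ∈ X, ∀ y₀ ∈ Y,
      ∀ Dx Dy : ℝ, 0 < Dx → 0 < Dy → Metric.diam X ≤ Dx → Metric.diam Y ≤ Dy →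
      ∀ Lx Lxy Ly L : ℝ, 0 ≤ Lx → 0 ≤ Lxy → 0 ≤ Ly → L = max Lx (max Lxy Ly) →
      ∀ ε : ℝ, 0 < ε →
      ∃ alg : FirstOrderMethod X Y,
        ∀ f : Eucl n → Eucl m → ℝ, IsSmoothOn X Y Lx Lxy Ly f → IsConvexConcaveOn X Y f →
          IsEpsSaddle X Y (regularized f ε Dx Dy x₀ y₀) (ε / 2)
            (alg.result (gradOracle X Y f)).1 (alg.result (gradOracle X Y f)).2 ∧
          IsEpsSaddle X Y f ε
            (alg.result (gradOracle X Y f)).1 (alg.result (gradOracle X Y f)).2 ∧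
          (alg.cost (gradOracle X Y f) : ℝ) ≤
            C * (1 + Real.sqrt ((Lx * Dx ^ 2 + Ly * Dy ^ 2) / ε)
                + Dx * Dy * Real.sqrt (L * Lxy) / ε)
              * Real.log (2 + L * (Dx + Dy) ^ 2 / ε) ^ 4 := by

  refine ⟨2000000000, by norm_num, ?_⟩
  intro n m X Y hXk hX hYk hY x₀ hx₀ y₀ hy₀ Dx Dy hDx hDy hdX hdY Lx Lxy Ly L hLx hLxy hLy hL ε hε
  have hLxL : Lx ≤ L := by rw [hL]; exact le_max_left _ _
  have hLxyL : Lxy ≤ L := by rw [hL]; exact (le_max_left _ _).trans (le_max_right _ _)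
  have hLyL : Ly ≤ L := by rw [hL]; exact (le_max_right _ _).trans (le_max_right _ _)
  have hL0 : 0 ≤ L := hLx.trans hLxL
  obtain ⟨Λ, hΛdef⟩ : ∃ Λ, Λ = 2 + L * (Dx + Dy) ^ 2 / ε := ⟨_, rfl⟩
  rw [← hΛdef]
  have hΛε : L * (Dx + Dy) ^ 2 = (Λ - 2) * ε := by rw [hΛdef]; field_simp; ring
  have hΛ : 2 ≤ Λ := by rw [hΛdef]; exact le_add_of_nonneg_right (by positivity)
  obtain ⟨μx, hμx⟩ : ∃ μx, μx = ε / (2 * Dx ^ 2) := ⟨_, rfl⟩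
  obtain ⟨μy, hμy⟩ : ∃ μy, μy = ε / (2 * Dy ^ 2) := ⟨_, rfl⟩
  have hμx0 : 0 < μx := by rw [hμx]; positivity
  have hμy0 : 0 < μy := by rw [hμy]; positivity
  have hμxε : 2 * μx * Dx ^ 2 = ε := by rw [hμx]; field_simp
  have hμyε : 2 * μy * Dy ^ 2 = ε := by rw [hμy]; field_simp
  have hDD : Dx ^ 2 ≤ (Dx + Dy) ^ 2 ∧ Dy ^ 2 ≤ (Dx + Dy) ^ 2 ∧ 4 * (Dx * Dy) ≤ (Dx + Dy) ^ 2 :=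
    ⟨by nlinarith, by nlinarith, by nlinarith [sq_nonneg (Dx - Dy)]⟩
  have hxx : ∀ {l}, 0 ≤ l → l ≤ L → l * Dx ^ 2 ≤ (Λ - 2) * ε := fun {l} h0 h => by
    rw [← hΛε]; exact mul_le_mul h hDD.1 (by positivity) hL0
  have hyy : ∀ {l}, 0 ≤ l → l ≤ L → l * Dy ^ 2 ≤ (Λ - 2) * ε := fun {l} h0 h => by
    rw [← hΛε]; exact mul_le_mul h hDD.2.1 (by positivity) hL0
  have hxy : 4 * (Lxy * (Dx * Dy)) ≤ (Λ - 2) * ε := by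
    rw [← hΛε]
    have := mul_le_mul hLxyL hDD.2.2 (by positivity) hL0
    linarith
  have hdivx : ∀ {l}, 0 ≤ l → l ≤ L → l / μx ≤ 2 * (Λ - 2) := fun {l} h0 h => by
    have e : l / μx = 2 * (l * Dx ^ 2 / ε) := by rw [hμx]; field_simp
    rw [e]
    exact mul_le_mul_of_nonneg_left ((div_le_iff₀ hε).2 (hxx h0 h)) (by norm_num)
  have hdivy : ∀ {l}, 0 ≤ l → l ≤ L → l / μy ≤ 2 * (Λ - 2) := fun {l} h0 h => by
    have e : l / μy = 2 * (l * Dy ^ 2 / ε) := by rw [hμy]; field_simp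
    rw [e]
    exact mul_le_mul_of_nonneg_left ((div_le_iff₀ hε).2 (hyy h0 h)) (by norm_num)
  -- The left side is the square of 4 Lxy Dx Dy/ε, and 4 Dx Dy ≤ (Dx + Dy)².
  have huv : 4 * (Lxy / μx * (Lxy / μy)) ≤ Λ ^ 2 := by
    have e : 4 * (Lxy / μx * (Lxy / μy)) = (4 * (Lxy * (Dx * Dy)) / ε) ^ 2 := by
      rw [hμx, hμy]; field_simp; ring
    rw [e]
    refine pow_le_pow_left₀ (by positivity) ?_ 2
    rw [div_le_iff₀ hε]
    nlinarith
  obtain ⟨N, ⟨S, hS, hS'⟩, hN⟩ := exists_reducesWithin hXk.isClosed hX hYk.isClosed hY hμx0 hμy0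
    hLx hLy hLxy hLxL hLyL hLxyL hΛ (hdivx hLx hLxL) (hdivy hLy hLyL) (hdivx hLxy hLxyL)
    (hdivy hLxy hLxyL) huv
  obtain ⟨PX, hPX⟩ := exists_projection ⟨x₀, hx₀⟩ hXk.isClosed hX
  obtain ⟨PY, hPY⟩ := exists_projection ⟨y₀, hy₀⟩ hYk.isClosed hY
  let reg : X × Y → Eucl n × Eucl m → Eucl n × Eucl m := fun q r =>
    (r.1 + μx • ((q.1 : Eucl n) - x₀), -r.2 + μy • ((q.2 : Eucl m) - y₀))
  let out : X × Y → Eucl n × Eucl m → X × Y := fun z r =>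
    (PX ((z.1 : Eucl n) - μx⁻¹ • (reg z r).1), PY ((z.2 : Eucl m) - μy⁻¹ • (reg z r).2))
  let z₀ : X × Y := (⟨x₀, hx₀⟩, ⟨y₀, hy₀⟩)
  -- One more query, at the solver's output, supplies the gradients for the final projected step.
  obtain ⟨alg, halg⟩ := ((hS z₀).translate reg id).bind (s := fun z o => out z (o z))
    fun z => (ComputableWithin.query z).map (out z)
  refine ⟨alg, fun f hs hc => ?_⟩
  obtain ⟨hres, hcost⟩ := halg (gradOracle X Y f)
  have ho := hs.saddleOracle_regularized hc hε.le hμx hμy x₀ y₀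
  obtain ⟨zs, hzs⟩ := ho.exists_isSaddle hμx0 hμy0 ⟨x₀, hx₀⟩ hXk.isClosed hX ⟨y₀, hy₀⟩
    hYk.isClosed hY
  have hXd : ∀ x ∈ X, ∀ u ∈ X, ‖x - u‖ ≤ Dx := fun x hx u hu => by
    rw [← dist_eq_norm]
    exact (Metric.dist_le_diam_of_mem hXk.isBounded hx hu).trans hdX
  have hYd : ∀ y ∈ Y, ∀ v ∈ Y, ‖y - v‖ ≤ Dy := fun y hy v hv => by
    rw [← dist_eq_norm]
    exact (Metric.dist_le_diam_of_mem hYk.isBounded hy hv).trans hdY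
  have hinit : wdist μx μy z₀ zs ≤ ε := by
    have g1 := mul_le_mul_of_nonneg_left
      (pow_le_pow_left₀ (norm_nonneg _) (hXd x₀ hx₀ zs.1 zs.1.2) 2) hμx0.le
    have g2 := mul_le_mul_of_nonneg_left
      (pow_le_pow_left₀ (norm_nonneg _) (hYd y₀ hy₀ zs.2 zs.2.2) 2) hμy0.le
    change μx * ‖x₀ - zs.1‖ ^ 2 + μy * ‖y₀ - zs.2‖ ^ 2 ≤ ε
    linarith
  generalize alg.result (gradOracle X Y f) = z' at hres ⊢
  have hδ0 : 0 ≤ 1 / Λ ^ 16 := by positivity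
  have hdist := (hS' _ _ ho zs hzs z₀).trans (mul_le_mul_of_nonneg_left hinit hδ0)
  dsimp only [id] at hres
  generalize S _ z₀ = z at hres hdist
  -- Here 3200 ≤ 2¹² ≤ Λ¹².
  have hδ : 3200 * Λ ^ 4 * (1 / Λ ^ 16) ≤ 1 := by
    have h1 : (2 : ℝ) ^ 12 ≤ Λ ^ 12 := pow_le_pow_left₀ (by norm_num) hΛ 12
    have h2 : Λ ^ 16 = Λ ^ 4 * Λ ^ 12 := by ring
    rw [mul_one_div, div_le_one (by positivity), h2, mul_comm (3200 : ℝ)]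
    exact mul_le_mul_of_nonneg_left (by linarith) (by positivity)
  have hΛ2 : (Λ - 2) * ε ≤ Λ * ε := by linarith
  have hresX : ∀ w : X, ⟪(z.1 : Eucl n) - μx⁻¹ • (reg z (gradOracle X Y f z)).1 - z'.1,
      (w : Eucl n) - z'.1⟫ ≤ 0 := by rw [hres]; exact hPX _
  have hresY : ∀ w : Y, ⟪(z.2 : Eucl m) - μy⁻¹ • (reg z (gradOracle X Y f z)).2 - z'.2,
      (w : Eucl m) - z'.2⟫ ≤ 0 := by rw [hres]; exact hPY _
  have hgap : ∀ x ∈ X, ∀ y ∈ Y, regularized f ε Dx Dy x₀ y₀ z'.1 y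
      - regularized f ε Dx Dy x₀ y₀ x z'.2 ≤ ε / 2 := by
    intro x hx y hy
    exact ho.gap_projected_step_le hμx0 hμy0 hDx hDy hLx hLy hLxy hμxε hμyε hΛ
      ((hxx hLx hLxL).trans hΛ2) ((hyy hLy hLyL).trans hΛ2) (hxy.trans hΛ2) hδ0 hδ hzs hdist
      hresX hresY (u := ⟨x, hx⟩) (v := ⟨y, hy⟩) (hXd _ z'.1.2 _ hx) (hYd _ z'.2.2 _ hy)
  obtain ⟨h1, h2⟩ := hs.isEpsSaddle hXk hYk hε.le hDx hDy z'.1.2 z'.2.2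
    (fun x hx => hXd x hx x₀ hx₀) (fun y hy => hYd y hy y₀ hy₀) hgap
  refine ⟨h1, h2, ?_⟩
  have hcost' : (alg.cost (gradOracle X Y f) : ℝ) ≤ N + 1 := by exact_mod_cast hcost
  exact hcost'.trans (oracle_calls_le hDx hDy hLx hLy hε hΛ hμx hμy hN)
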